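/- **Setting.** Fix integers $K\ge 2$ (number of communities), $L>T\ge 1$ (walk length and window size), a real $\rho\in(\tfrac13,1)$ and constants $c\in\mathbb R$, $\delta>0$, $\eta_{\max}>0$, $\zeta>0$. Norms of vectors are Euclidean and norms of matrices are spectral norms; $D_M=\mathrm{diag}(M\mathbf 1)$. Let $n$ be divisible by $K$, let $\mathbb V_1,\dots,\mathbb V_K$ be a partition of $[n]$ into clusters of size $n/K$, and let $0<q<p<1$ with $p-q\ge \delta p$. Let $G$ be drawn from the symmetric stochastic block model: its adjacency matrix $A$ is a symmetric $0/1$ matrix whose entries $A_{ij}$, $i<j$, are independent Bernoulli variables with parameter $p$ if $i,j$ lie in the same cluster and $q$ otherwise. With $d_i=\sum_j A_{ij}$, $\pi_i=d_i/\sum_k d_k$ and $P=D_A^{-1}A$, the co-occurrence matrix is $$C_{ij}=2\sum_{t=1}^{T}(L-t)\,\pi_i\,(P^t)_{ij}.$$ Let $\overline A$ be the matrix with entries $p$ inside and $q$ across clusters, $\overline P=D_{\overline A}^{-1}\overline A$, $\overline d=\frac nK p+\frac{n(K-1)}K q$, and $\overline C=2\sum_{t=1}^T\frac{L-t}{n\overline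 d}D_{\overline A}\overline P^t$. **Algorithm.** Let $\epsilon=n^{-2/3}$, $\Delta=n^{1/6}$ and let $\eta>0$ be the learning rate. Draw $g\in\mathbb R^{2n}$ with independent $\mathcal N(0,1)$ entries and put $w^{(0)}=\epsilon\, g/\|g\|$. For $w^{(t)}=(x^{(t)},y^{(t)})$ with $x^{(t)},y^{(t)}\in\mathbb R^n$ let $Q^{(t)}_{ij}=\exp(x^{(t)}_iy^{(t)}_j)/\sum_k\exp(x^{(t)}_iy^{(t)}_k)$, $G^{(t)}=D_CQ^{(t)}-C$ and $$w^{(t+1)}=\begin{bmatrix} I&-\eta G^{(t)}\\-\eta (G^{(t)})^{\top}&I\end{bmatrix}w^{(t)}.$$ The algorithm stops at the first $t_f\ge 1$ with $\|w^{(t_f)}\|\ge\epsilon\Delta$ and outputs the embedding $x=x^{(t_f)}$. **Theorem.** There is $n_0$, depending only on $K,L,T,\rho,c,\delta,\eta_{\max},\zeta$, such that the following holds for all $n\ge n_0$, all clusters and $p,q$ as above, and all $\eta\in(0,\eta_{\max}]$. For almost every realization of $G$ for which $C=\overline C+R$ with $R$ symmetric and $\|R\|<\dfrac{c}{\sqrt{n^{\rho+2}}}$,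 with probability at least $1-\zeta$ over the Gaussian initialization the algorithm stops, and its output $x$ satisfies $$\|x-\mu\|\le\frac{5\|x\|}{\Delta},$$ where $\mu\in\mathbb R^n$ is the vector of cluster means: $\mu_j=\frac1{|\mathbb V_i|}\sum_{r\in\mathbb V_i}x_r$ for $j\in\mathbb V_i$. -/

import Mathlib

open MeasureTheory ProbabilityTheory Matrix
open scoped BigOperators

noncomputable section

namespace DeepWalk

variable {n K : ℕ}

/-- Spectral norm: the operator norm of a real matrix for the Euclidean norm. -/
def specNorm (M : Matrix (Fin n) (Fin n) ℝ) : ℝ :=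
  ‖Matrix.toEuclideanCLM (n := Fin n) (𝕜 := ℝ) M‖

/-- The vector of row sums `M 𝟏` (vertex degrees when `M` is an adjacency matrix). -/
def deg (M : Matrix (Fin n) (Fin n) ℝ) : Fin n → ℝ := fun i => ∑ j, M i j

/-- The degree operator `D_M = diag (M 𝟏)`. -/
def degMatrix (M : Matrix (Fin n) (Fin n) ℝ) : Matrix (Fin n) (Fin n) ℝ :=
  Matrix.diagonal (deg M)

/-- The transition matrix `P = D_A⁻¹ A` (the row of an isolated vertex is zero). -/
def transition (A : Matrix (Fin n) (Fin n) ℝ) : Matrix (Fin n) (Fin n) ℝ :=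
  Matrix.of fun i j => A i j / deg A i

/-- The stationary distribution `π_i = d_i / (2|E|)`, where `2|E|` is the sum of all degrees. -/
def stationary (A : Matrix (Fin n) (Fin n) ℝ) : Fin n → ℝ :=
  fun i => deg A i / ∑ k, deg A k

/-- The (per-walk) co-occurrence matrix of the graph with adjacency matrix `A`, for stationary
random walks of length `L` and window size `T`:
`C_ij = 2 ∑_{t=1}^T (L - t) π_i (P^t)_ij`. -/
def coOccurrence (L T : ℕ) (A : Matrix (Fin n) (Fin n) ℝ) : Matrix (Fin n) (Fin n) ℝ :=
  Matrix.of fun i j =>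
    2 * ∑ t ∈ Finset.Icc 1 T, ((L : ℝ) - (t : ℝ)) * (stationary A i * (transition A ^ t) i j)

/-- The `K` clusters given by the labelling `σ` all have size `n / K`. -/
def Balanced (σ : Fin n → Fin K) : Prop :=
  ∀ k : Fin K, K * (Finset.univ.filter fun i => σ i = k).card = n

/-- The probability matrix of the symmetric SBM (`= Ā`): `p` inside clusters, `q` across. -/
def probMatrix (σ : Fin n → Fin K) (p q : ℝ) : Matrix (Fin n) (Fin n) ℝ :=
  Matrix.of fun i j => if σ i = σ j then p else q

/-- The expected degree `d̄ = (n/K) p + (n (K-1)/K) q`. -/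
def expectedDegree (n K : ℕ) (p q : ℝ) : ℝ :=
  (n : ℝ) / K * p + (n : ℝ) * ((K : ℝ) - 1) / K * q

/-- The ideal co-occurrence matrix `C̄ = 2 ∑_{t=1}^T (L - t)/(n d̄) D_Ā P̄^t`, `P̄ = D_Ā⁻¹ Ā`. -/
def expectedCoOccurrence (L T : ℕ) (σ : Fin n → Fin K) (p q : ℝ) :
    Matrix (Fin n) (Fin n) ℝ :=
  (2 : ℝ) • ∑ t ∈ Finset.Icc 1 T,
    (((L : ℝ) - (t : ℝ)) / ((n : ℝ) * expectedDegree n K p q)) •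
      (degMatrix (probMatrix σ p q) * transition (probMatrix σ p q) ^ t)

/-- `A` is the random adjacency matrix of a graph drawn from the symmetric SBM with clusters `σ`
and parameters `p, q`: it is symmetric with entries in `{0,1}`, and the entries above the diagonal
are independent Bernoulli variables with parameter `p` inside clusters and `q` across clusters.
The diagonal is left free, so that both the convention without self-loops and the one in which
self-loops are drawn as well are covered. -/
structure IsSymmetricSBM {Ω : Type*} [MeasurableSpace Ω] (P : Measure Ω)
    (A : Ω → Matrix (Fin n) (Fin n) ℝ) (σ : Fin n → Fin K) (p q : ℝ) : Prop where
  zero_or_one : ∀ ω i j, A ω i j = 0 ∨ A ω i j = 1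
  symm : ∀ ω, (A ω).IsSymm
  measurable : ∀ i j, Measurable fun ω => A ω i j
  prob : ∀ i j, i < j → P {ω | A ω i j = 1} = ENNReal.ofReal (probMatrix σ p q i j)
  indep : iIndepFun
    (fun (e : {e : Fin n × Fin n // e.1 < e.2}) ω => A ω e.1.1 e.1.2) P

/-- `C = C̄ + R` with `R` symmetric and `‖R‖ < c / √(n^(ρ+2))`. -/
def CloseToExpected (c ρ : ℝ) (C Cbar : Matrix (Fin n) (Fin n) ℝ) : Prop :=
  ∃ R : Matrix (Fin n) (Fin n) ℝ,
    R.IsSymm ∧ C = Cbar + R ∧ specNorm R < c / Real.sqrt ((n : ℝ) ^ (ρ + 2))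

/-- The parameter `ε = n^(-2/3)`. -/
def eps (n : ℕ) : ℝ := 1 / (n : ℝ) ^ (2 / 3 : ℝ)

/-- The parameter `Δ = n^(1/6)`. -/
def Del (n : ℕ) : ℝ := (n : ℝ) ^ (1 / 6 : ℝ)

/-- The joint vector `w = (x, y)` of node and context embeddings, with the Euclidean norm. -/
abbrev Emb (n : ℕ) := EuclideanSpace ℝ (Fin n ⊕ Fin n)

/-- The node embedding `x` (first `n` coordinates of `w`). -/
def xPart (w : Emb n) : EuclideanSpace ℝ (Fin n) := WithLp.toLp 2 fun i => w (Sum.inl i)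

/-- The context embedding `y` (last `n` coordinates of `w`). -/
def yPart (w : Emb n) : EuclideanSpace ℝ (Fin n) := WithLp.toLp 2 fun i => w (Sum.inr i)

/-- The softmax matrix `Q_ij = exp (x_i y_j) / ∑_k exp (x_i y_k)`. -/
def softmaxMatrix (w : Emb n) : Matrix (Fin n) (Fin n) ℝ :=
  Matrix.of fun i j =>
    Real.exp (xPart w i * yPart w j) / ∑ k, Real.exp (xPart w i * yPart w k)

/-- `G = D_C Q - C`. -/
def gradMatrix (C : Matrix (Fin n) (Fin n) ℝ) (w : Emb n) : Matrix (Fin n) (Fin n) ℝ :=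
  degMatrix C * softmaxMatrix w - C

/-- One gradient descent update `w ↦ [[I, -ηG], [-ηGᵀ, I]] w`. -/
def gdStep (C : Matrix (Fin n) (Fin n) ℝ) (η : ℝ) (w : Emb n) : Emb n :=
  WithLp.toLp 2
    (Matrix.fromBlocks 1 (-(η • gradMatrix C w)) (-(η • (gradMatrix C w)ᵀ)) 1 *ᵥ w.ofLp)

/-- The normalized initialization `w⁽⁰⁾ = ε g / ‖g‖`. -/
def initVec (g : Fin n ⊕ Fin n → ℝ) : Emb n :=
  (eps n / ‖(WithLp.toLp 2 g : Emb n)‖) • (WithLp.toLp 2 g : Emb n)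

/-- The iterates `w⁽ᵗ⁾` of gradient descent started from the raw Gaussian sample `g`. -/
def iterate (C : Matrix (Fin n) (Fin n) ℝ) (η : ℝ) (g : Fin n ⊕ Fin n → ℝ) (t : ℕ) : Emb n :=
  (gdStep C η)^[t] (initVec g)

/-- The algorithm (repeat the update until `‖w⁽ᵗ⁾‖ ≥ ε Δ`) stops after exactly `tf` updates. -/
def StopsAt (C : Matrix (Fin n) (Fin n) ℝ) (η : ℝ) (g : Fin n ⊕ Fin n → ℝ) (tf : ℕ) : Prop :=
  IsLeast {t : ℕ | 1 ≤ t ∧ eps n * Del n ≤ ‖iterate C η g t‖} tf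

/-- Law of the raw initialization: `2n` independent standard Gaussians. -/
def gaussianInit (n : ℕ) : Measure (Fin n ⊕ Fin n → ℝ) :=
  Measure.pi fun _ => gaussianReal 0 1

/-- The vector of means: `μ_j` is the average of `x` over the cluster containing `j`. -/
def meanVec (σ : Fin n → Fin K) (x : EuclideanSpace ℝ (Fin n)) : EuclideanSpace ℝ (Fin n) :=
  WithLp.toLp 2 fun j =>
    (∑ r ∈ Finset.univ.filter (fun r => σ r = σ j), x r) /
      ((Finset.univ.filter fun r => σ r = σ j).card : ℝ)

end DeepWalk

end

noncomputable section

namespace DeepWalk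

/-! Write `J = meanProj n`, `Π = clusterProj σ` and `Z = Π - J`. Since `D_C J = C J`, the gradient
matrix is `G = D_C (Q - J) - C (1 - J)`. Before stopping, `‖w‖² < (εΔ)² = 1/n`, so all products `x_i
y_j` are tiny, `Q` is close to `J`, and the first term is negligible. The expected matrix `C̄` is a
combination of `J` and `Z`, so `C (1 - J) = b Z + R (1 - J)` with `b` of order `1/n`. Gradient
descent is thus nearly a power iteration for the dilation of `H = b Z + R (1 - J)`.

Growth: let `v` be a unit eigenvector of this dilation with eigenvalue at least `b - ‖R‖`. The
component of `w` along `v` grows by a factor `1 + ηl` per step, `l` of order `1/n`, up to the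
softmax error alone. It is essential that `v` belongs to the perturbed matrix: the crude bound on
`R`, treated as an additive error, could exceed an initial overlap of order `ε/√n`. The norm hence
reaches `εΔ` after at most order `n log n / η` steps (`exists_stopping_time`).

Control: `(1 - Π) Z = 0`, so `x - μ` is driven only by `R` and the softmax error, and `x - y` is
contracted by the `Z` part up to the same errors. The total drift is of order `log n · n^(-ρ/2) ·
εΔ`, which is `o(ε)` exactly because `ρ > 1/3`. At the stopping time `‖x - μ‖` and `‖x - y‖` are
still `O(ε)` while `‖w‖ ≥ εΔ`, so `‖x‖` is comparable to `‖w‖` and the ratio is `O(1/Δ)`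
(`descent_recovers`).

Randomness: `v` depends only on `C`, so it suffices that `⟨v, g⟩` is not too small and `‖g‖²` is
`O(n)`. -/

/-! ### Small-ball and norm bounds for the Gaussian initialization -/

/-- The standard Gaussian density is at most `1/√(2π) ≤ 1/2`, and the interval has length `2κ`. -/
lemma gaussianReal_abs_le (κ : ℝ) :
    gaussianReal 0 1 {x | |x| ≤ κ} ≤ ENNReal.ofReal κ := by
  have hset : {x : ℝ | |x| ≤ κ} = Set.Icc (-κ) κ := by
    ext x; simp [abs_le]
  rw [hset, gaussianReal_apply 0 one_ne_zero]
  have hpi : (2 : ℝ) ≤ √(2 * Real.pi) := by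
    apply Real.le_sqrt_of_sq_le
    nlinarith [Real.pi_gt_three]
  calc ∫⁻ x in Set.Icc (-κ) κ, gaussianPDF 0 1 x
      ≤ ∫⁻ _ in Set.Icc (-κ) κ, ENNReal.ofReal (1 / 2) := by
        apply lintegral_mono
        intro x
        apply ENNReal.ofReal_le_ofReal
        rw [gaussianPDFReal]
        have h1 : Real.exp (-(x - 0) ^ 2 / (2 * ((1 : NNReal) : ℝ))) ≤ 1 := by
          rw [Real.exp_le_one_iff]
          simp only [sub_zero, NNReal.coe_one, mul_one]
          nlinarith [sq_nonneg x]
        have h2 : (√(2 * Real.pi * ((1 : NNReal) : ℝ)))⁻¹ ≤ 1 / 2 := by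
          rw [NNReal.coe_one, mul_one, one_div]
          exact inv_anti₀ (by norm_num) hpi
        calc _ ≤ (1 / 2 : ℝ) * 1 :=
              mul_le_mul h2 h1 (Real.exp_nonneg _) (by norm_num)
          _ = 1 / 2 := mul_one _
    _ = ENNReal.ofReal κ := by
        rw [setLIntegral_const, Real.volume_Icc, ← ENNReal.ofReal_mul (by norm_num)]
        congr 1; ring

lemma stdGaussian_abs_inner_le {E : Type*} [NormedAddCommGroup E] [InnerProductSpace ℝ E]
    [FiniteDimensional ℝ E] [MeasurableSpace E] [BorelSpace E] (v : E) (hv : ‖v‖ = 1)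
    (κ : ℝ) :
    stdGaussian E {g | |inner ℝ v g| ≤ κ} ≤ ENNReal.ofReal κ := by
  have hmap : (stdGaussian E).map (innerSL ℝ v) = gaussianReal 0 1 := by
    rw [IsGaussian.map_eq_gaussianReal, integral_strongDual_stdGaussian,
      variance_dual_stdGaussian, innerSL_apply_norm, hv]
    simp
  have hm : MeasurableSet {x : ℝ | |x| ≤ κ} :=
    measurableSet_le measurable_norm measurable_const
  have := gaussianReal_abs_le κ
  rw [← hmap, Measure.map_apply (innerSL ℝ v).continuous.measurable hm] at this
  exact this

lemma gaussianInit_abs_inner_le {n : ℕ} (v : Emb n) (hv : ‖v‖ = 1) (κ : ℝ) :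
    gaussianInit n {g | |inner ℝ v (WithLp.toLp 2 g : Emb n)| ≤ κ} ≤ ENNReal.ofReal κ := by
  have h := stdGaussian_abs_inner_le v hv κ
  rw [← map_pi_eq_stdGaussian, Measure.map_apply (by fun_prop)
    (measurableSet_le (by fun_prop) measurable_const)] at h
  exact h

/-- Markov's inequality with `E‖g‖² = 2n`. -/
lemma gaussianInit_le_norm_sq {n : ℕ} (hn : 0 < n) (B : ℝ) (hB : 0 < B) :
    gaussianInit n {g | 2 * n * B ≤ ‖(WithLp.toLp 2 g : Emb n)‖ ^ 2} ≤ ENNReal.ofReal (1 / B) := by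
  have hn' : (0 : ℝ) < n := by exact_mod_cast hn
  have hone : ∫⁻ x, ENNReal.ofReal (x ^ 2) ∂(gaussianReal 0 1) = 1 := by
    rw [← ofReal_integral_eq_lintegral_ofReal]
    · have h := variance_fun_id_gaussianReal (μ := 0) (v := 1)
      rw [variance_of_integral_eq_zero (by fun_prop) (by simp)] at h
      rw [h]; simp
    · exact (memLp_id_gaussianReal 2).integrable_sq
    · exact Filter.Eventually.of_forall fun x => sq_nonneg x
  have hint : ∫⁻ g, ENNReal.ofReal (‖(WithLp.toLp 2 g : Emb n)‖ ^ 2) ∂(gaussianInit n)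
      = ENNReal.ofReal (2 * n) := by
    calc _ = ∫⁻ g, ∑ i, ENNReal.ofReal ((g i) ^ 2) ∂(gaussianInit n) := by
          refine lintegral_congr fun g => ?_
          rw [EuclideanSpace.norm_sq_eq, ENNReal.ofReal_sum_of_nonneg (fun i _ => by positivity)]
          simp
      _ = ∑ i : Fin n ⊕ Fin n, ∫⁻ g, ENNReal.ofReal ((g i) ^ 2) ∂(gaussianInit n) := by
          rw [lintegral_finsetSum]
          intro i _; fun_prop
      _ = ∑ i : Fin n ⊕ Fin n, 1 := by
          refine Finset.sum_congr rfl fun i _ => ?_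
          rw [← hone]
          exact (measurePreserving_eval (fun _ : Fin n ⊕ Fin n => gaussianReal 0 1) i).lintegral_comp
            (f := fun x => ENNReal.ofReal (x ^ 2)) (by fun_prop)
      _ = ENNReal.ofReal (2 * n) := by
          simp only [Finset.sum_const, Finset.card_univ, Fintype.card_sum, Fintype.card_fin,
            nsmul_eq_mul, mul_one]
          rw [← two_mul]
          rw [← ENNReal.ofReal_natCast]; push_cast; rfl
  have hmark := mul_meas_ge_le_lintegral₀ (μ := gaussianInit n)
    (f := fun g => ENNReal.ofReal (‖(WithLp.toLp 2 g : Emb n)‖ ^ 2)) (by fun_prop)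
    (ENNReal.ofReal (2 * n * B))
  rw [hint] at hmark
  have hpos : (0 : ℝ) < 2 * n * B := by positivity
  have hset : {g : Fin n ⊕ Fin n → ℝ | 2 * n * B ≤ ‖(WithLp.toLp 2 g : Emb n)‖ ^ 2} ⊆
      {g | ENNReal.ofReal (2 * n * B) ≤ ENNReal.ofReal (‖(WithLp.toLp 2 g : Emb n)‖ ^ 2)} :=
    fun g hg => ENNReal.ofReal_le_ofReal hg
  refine (measure_mono hset).trans ?_
  have h3 : ENNReal.ofReal (1 / B) = ENNReal.ofReal (2 * n) / ENNReal.ofReal (2 * n * B) := by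
    rw [← ENNReal.ofReal_div_of_pos hpos]
    congr 1; field_simp
  rw [h3, ENNReal.le_div_iff_mul_le (Or.inl (ENNReal.ofReal_pos.2 hpos).ne') (Or.inl ENNReal.ofReal_ne_top),
    mul_comm]
  exact hmark

/-! ### The algebra of the averaging projections -/

open scoped Matrix.Norms.L2Operator

variable {n K : ℕ}

/-- The orthogonal projection `𝟏𝟏ᵀ / n` onto constant vectors. -/
def meanProj (n : ℕ) : Matrix (Fin n) (Fin n) ℝ := Matrix.of fun _ _ => 1 / (n : ℝ)

/-- Averaging over the clusters of `σ`. -/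
def clusterProj (σ : Fin n → Fin K) : Matrix (Fin n) (Fin n) ℝ :=
  Matrix.of fun i j => if σ i = σ j then (K : ℝ) / n else 0

/-- The projection onto mean-zero vectors that are constant on clusters. -/
def communityProj (σ : Fin n → Fin K) : Matrix (Fin n) (Fin n) ℝ := clusterProj σ - meanProj n

/-- The second eigenvalue of the expected transition matrix. -/
def communityEigenvalue (K : ℕ) (p q : ℝ) : ℝ := (p - q) / (p + ((K : ℝ) - 1) * q)

lemma card_cluster {σ : Fin n → Fin K} (hσ : Balanced σ) (hK : 0 < K) (k : Fin K) :
    ((Finset.univ.filter fun i => σ i = k).card : ℝ) = n / K := by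
  have hK' : (0 : ℝ) < K := by exact_mod_cast hK
  rw [eq_div_iff hK'.ne', mul_comm]
  exact_mod_cast hσ k

lemma sum_ite_cluster {σ : Fin n → Fin K} (hσ : Balanced σ) (hK : 0 < K) (k : Fin K) (a b : ℝ) :
    ∑ j, (if k = σ j then a else b) = n / K * a + (n - n / K) * b := by
  have h := card_cluster hσ hK k
  have h2 : ∀ j, (if k = σ j then a else b) = (if σ j = k then 1 else 0) * (a - b) + b := by
    intro j
    by_cases hj : σ j = k
    · simp [hj]
    · simp [hj, Ne.symm hj]
  simp_rw [h2, Finset.sum_add_distrib, ← Finset.sum_mul, Finset.sum_boole]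
  rw [h]
  simp
  ring

lemma meanProj_mul_self (hn : 0 < n) : meanProj n * meanProj n = meanProj n := by
  have hn' : (n : ℝ) ≠ 0 := by positivity
  ext i j
  simp [meanProj, Matrix.mul_apply, hn']

lemma clusterProj_mul_self {σ : Fin n → Fin K} (hσ : Balanced σ) (hK : 0 < K) (hn : 0 < n) :
    clusterProj σ * clusterProj σ = clusterProj σ := by
  have hn' : (n : ℝ) ≠ 0 := by positivity
  have hK' : (K : ℝ) ≠ 0 := by positivity
  ext i j
  simp only [clusterProj, Matrix.mul_apply, Matrix.of_apply]
  by_cases hij : σ i = σ j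
  · have : ∀ k, (if σ i = σ k then (K : ℝ) / n else 0) * (if σ k = σ j then (K : ℝ) / n else 0)
        = if σ i = σ k then ((K : ℝ) / n) * (K / n) else 0 := by
      intro k
      by_cases h : σ i = σ k
      · rw [if_pos h, if_pos (h ▸ hij), if_pos h]
      · simp [h]
    simp_rw [this]
    rw [sum_ite_cluster hσ hK, if_pos hij]
    field_simp
    ring
  · rw [if_neg hij]
    refine Finset.sum_eq_zero fun k _ => ?_
    by_cases h : σ i = σ k
    · rw [if_neg (fun h' => hij (h.trans h')), mul_zero]
    · rw [if_neg h, zero_mul]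

lemma clusterProj_mul_meanProj {σ : Fin n → Fin K} (hσ : Balanced σ) (hK : 0 < K) (hn : 0 < n) :
    clusterProj σ * meanProj n = meanProj n := by
  have hn' : (n : ℝ) ≠ 0 := by positivity
  have hK' : (K : ℝ) ≠ 0 := by positivity
  ext i j
  simp only [clusterProj, meanProj, Matrix.mul_apply, Matrix.of_apply]
  rw [← Finset.sum_mul, sum_ite_cluster hσ hK]
  field_simp
  ring

lemma meanProj_isSymm : (meanProj n)ᵀ = meanProj n := rfl

lemma clusterProj_isSymm (σ : Fin n → Fin K) : (clusterProj σ)ᵀ = clusterProj σ := by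
  ext i j
  simp [clusterProj, eq_comm]

lemma communityProj_isSymm (σ : Fin n → Fin K) : (communityProj σ)ᵀ = communityProj σ := by
  rw [communityProj, transpose_sub, clusterProj_isSymm, meanProj_isSymm]

lemma meanProj_mul_clusterProj {σ : Fin n → Fin K} (hσ : Balanced σ) (hK : 0 < K) (hn : 0 < n) :
    meanProj n * clusterProj σ = meanProj n := by
  have h := congrArg Matrix.transpose (clusterProj_mul_meanProj hσ hK hn)
  rwa [transpose_mul, clusterProj_isSymm, meanProj_isSymm] at h

lemma communityProj_mul_self {σ : Fin n → Fin K} (hσ : Balanced σ) (hK : 0 < K) (hn : 0 < n) :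
    communityProj σ * communityProj σ = communityProj σ := by
  rw [communityProj, mul_sub, sub_mul, sub_mul, clusterProj_mul_self hσ hK hn,
    meanProj_mul_clusterProj hσ hK hn, clusterProj_mul_meanProj hσ hK hn, meanProj_mul_self hn]
  abel

lemma communityProj_mul_meanProj {σ : Fin n → Fin K} (hσ : Balanced σ) (hK : 0 < K) (hn : 0 < n) :
    communityProj σ * meanProj n = 0 := by
  rw [communityProj, sub_mul, clusterProj_mul_meanProj hσ hK hn, meanProj_mul_self hn, sub_self]

lemma meanProj_mul_communityProj {σ : Fin n → Fin K} (hσ : Balanced σ) (hK : 0 < K) (hn : 0 < n) :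
    meanProj n * communityProj σ = 0 := by
  rw [communityProj, mul_sub, meanProj_mul_clusterProj hσ hK hn, meanProj_mul_self hn, sub_self]

lemma one_sub_clusterProj_mul_communityProj {σ : Fin n → Fin K} (hσ : Balanced σ) (hK : 0 < K)
    (hn : 0 < n) : (1 - clusterProj σ) * communityProj σ = 0 := by
  rw [communityProj, sub_mul, one_mul, mul_sub, clusterProj_mul_self hσ hK hn,
    clusterProj_mul_meanProj hσ hK hn, sub_self]

lemma norm_one_sub_le_one {P : Matrix (Fin n) (Fin n) ℝ} (hs : Pᵀ = P) (hP : P * P = P) :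
    ‖1 - P‖ ≤ 1 := by
  apply IsStarProjection.norm_le
  refine IsStarProjection.one_sub ⟨hP, ?_⟩
  rw [isSelfAdjoint_iff, star_eq_conjTranspose, conjTranspose_eq_transpose_of_trivial, hs]

/-! ### The expected co-occurrence matrix -/

lemma deg_probMatrix {σ : Fin n → Fin K} (hσ : Balanced σ) (hK : 0 < K) (p q : ℝ) (i : Fin n) :
    deg (probMatrix σ p q) i = expectedDegree n K p q := by
  have hK' : (K : ℝ) ≠ 0 := by positivity
  simp only [deg, probMatrix, Matrix.of_apply, expectedDegree]
  rw [sum_ite_cluster hσ hK]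
  field_simp

lemma transition_probMatrix {σ : Fin n → Fin K} (hσ : Balanced σ) (hK : 0 < K) (hn : 0 < n)
    {p q : ℝ} (hs : 0 < p + ((K : ℝ) - 1) * q) :
    transition (probMatrix σ p q) =
      meanProj n + communityEigenvalue K p q • communityProj σ := by
  have hn' : (n : ℝ) ≠ 0 := by positivity
  have hK' : (K : ℝ) ≠ 0 := by positivity
  obtain ⟨s, rfl⟩ : ∃ s, p = s - ((K : ℝ) - 1) * q := ⟨p + ((K : ℝ) - 1) * q, by ring⟩
  rw [sub_add_cancel] at hs
  have hs' := hs.ne'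
  have hd : expectedDegree n K (s - ((K : ℝ) - 1) * q) q = n / K * s := by
    rw [expectedDegree]; field_simp; ring
  ext i j
  simp only [transition, Matrix.of_apply, deg_probMatrix hσ hK, hd]
  simp only [communityEigenvalue, sub_add_cancel, Matrix.of_apply, communityProj, clusterProj, meanProj, probMatrix, Matrix.add_apply, Matrix.smul_apply,
    Matrix.sub_apply, smul_eq_mul]
  split_ifs
  · field_simp
    ring
  · field_simp
    ring

/-- This is the spectral decomposition of `P̄`: the two projections are orthogonal, so only the
coefficients are raised to the power. It needs `1 ≤ t`, because their sum is `clusterProj σ` and not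
the identity. -/
lemma transition_probMatrix_pow {σ : Fin n → Fin K} (hσ : Balanced σ) (hK : 0 < K) (hn : 0 < n)
    {p q : ℝ} (hs : 0 < p + ((K : ℝ) - 1) * q) {t : ℕ} (ht : 1 ≤ t) :
    transition (probMatrix σ p q) ^ t =
      meanProj n + communityEigenvalue K p q ^ t • communityProj σ := by
  induction t, ht using Nat.le_induction with
  | base => rw [pow_one, pow_one, transition_probMatrix hσ hK hn hs]
  | succ t _ ih =>
    rw [pow_succ, ih, transition_probMatrix hσ hK hn hs, add_mul, mul_add, mul_add,
      meanProj_mul_self hn, mul_smul_comm, meanProj_mul_communityProj hσ hK hn, smul_mul_assoc,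
      communityProj_mul_meanProj hσ hK hn, smul_mul_smul_comm, communityProj_mul_self hσ hK hn,
      pow_succ]
    simp

/-- `n` times the eigenvalue of `C̄` on constant vectors. -/
def walkWeight (L T : ℕ) : ℝ := 2 * ∑ t ∈ Finset.Icc 1 T, ((L : ℝ) - t)

/-- `n` times the eigenvalue of `C̄` on mean-zero cluster vectors. -/
def communityWeight (K L T : ℕ) (p q : ℝ) : ℝ :=
  2 * ∑ t ∈ Finset.Icc 1 T, ((L : ℝ) - t) * communityEigenvalue K p q ^ t

lemma expectedCoOccurrence_eq {σ : Fin n → Fin K} (hσ : Balanced σ) (hK : 0 < K) (hn : 0 < n)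
    {p q : ℝ} (hs : 0 < p + ((K : ℝ) - 1) * q) (L T : ℕ) :
    expectedCoOccurrence L T σ p q =
      (walkWeight L T / n) • meanProj n + (communityWeight K L T p q / n) • communityProj σ := by
  have hn' : (n : ℝ) ≠ 0 := by positivity
  have hK' : (0 : ℝ) < K := by positivity
  have hd : expectedDegree n K p q ≠ 0 := by
    have : expectedDegree n K p q = n / K * (p + ((K : ℝ) - 1) * q) := by
      rw [expectedDegree]; field_simp
    rw [this]; positivity
  have hD : degMatrix (probMatrix σ p q) = expectedDegree n K p q • (1 : Matrix _ _ ℝ) := by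
    rw [degMatrix, smul_one_eq_diagonal]
    congr 1
    funext i
    exact deg_probMatrix hσ hK p q i
  have hterm : ∀ t ∈ Finset.Icc 1 T,
      (((L : ℝ) - (t : ℝ)) / ((n : ℝ) * expectedDegree n K p q)) •
        (degMatrix (probMatrix σ p q) * transition (probMatrix σ p q) ^ t) =
      (((L : ℝ) - t) / n) • meanProj n +
        (((L : ℝ) - t) * communityEigenvalue K p q ^ t / n) • communityProj σ := by
    intro t ht
    rw [hD, smul_mul_assoc, one_mul, smul_smul,
      transition_probMatrix_pow hσ hK hn hs (Finset.mem_Icc.1 ht).1, smul_add, smul_smul]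
    congr 2 <;> field_simp
  rw [expectedCoOccurrence, Finset.sum_congr rfl hterm, Finset.sum_add_distrib,
    ← Finset.sum_smul, ← Finset.sum_smul, ← Finset.sum_div, ← Finset.sum_div, smul_add, smul_smul,
    smul_smul, walkWeight, communityWeight]
  congr 2 <;> ring

lemma communityEigenvalue_bounds (hK : 2 ≤ K) {p q δ : ℝ} (hq : 0 < q) (hqp : q < p)
    (hpq : δ * p ≤ p - q) :
    δ / K ≤ communityEigenvalue K p q ∧ 0 ≤ communityEigenvalue K p q ∧
      communityEigenvalue K p q ≤ 1 := by
  have hK' : (2 : ℝ) ≤ K := by exact_mod_cast hK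
  have hs : 0 < p + ((K : ℝ) - 1) * q := by nlinarith
  have hpos : 0 ≤ communityEigenvalue K p q := div_nonneg (by linarith) hs.le
  refine ⟨?_, hpos, ?_⟩
  · rw [communityEigenvalue, div_le_div_iff₀ (by linarith) hs]
    by_cases hδ : 0 ≤ δ
    · nlinarith [mul_nonneg hδ (mul_nonneg (by linarith : (0 : ℝ) ≤ K - 1) (sub_pos.2 hqp).le)]
    · nlinarith [mul_pos (neg_pos.2 (not_le.1 hδ)) hs, mul_pos (by linarith : (0:ℝ) < K)
        (sub_pos.2 hqp)]
  · rw [communityEigenvalue, div_le_one hs]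
    nlinarith

/-- The term `t = 1` alone gives the lower bound, which forces growth in the community directions.
The upper bound serves to keep `η * b ≤ 1`. -/
lemma communityWeight_bounds (hK : 2 ≤ K) {L T : ℕ} (hT : 1 ≤ T) (hTL : T < L) {p q δ : ℝ}
    (hq : 0 < q) (hqp : q < p) (hpq : δ * p ≤ p - q) :
    2 * δ / K ≤ communityWeight K L T p q ∧ communityWeight K L T p q ≤ walkWeight L T := by
  obtain ⟨h1, h0, h2⟩ := communityEigenvalue_bounds hK hq hqp hpq
  have hL : ∀ t ∈ Finset.Icc 1 T, (1 : ℝ) ≤ (L : ℝ) - t := by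
    intro t ht
    have : t + 1 ≤ L := by have := (Finset.mem_Icc.1 ht).2; omega
    have : (t : ℝ) + 1 ≤ L := by exact_mod_cast this
    linarith
  constructor
  · have h := Finset.single_le_sum (f := fun t : ℕ => ((L : ℝ) - t) * communityEigenvalue K p q ^ t)
      (fun t ht => mul_nonneg (by linarith [hL t ht]) (pow_nonneg h0 t))
      (Finset.mem_Icc.2 ⟨le_rfl, hT⟩)
    have hL1 := hL 1 (Finset.mem_Icc.2 ⟨le_rfl, hT⟩)
    simp only [pow_one] at h
    rw [communityWeight, mul_div_assoc]
    nlinarith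
  · rw [communityWeight, walkWeight]
    refine mul_le_mul_of_nonneg_left (Finset.sum_le_sum fun t ht => ?_) zero_le_two
    exact mul_le_of_le_one_right (by linarith [hL t ht]) (pow_le_one₀ h0 h2)

/-! ### The gradient matrix near the origin -/

lemma degMatrix_mul_meanProj (M : Matrix (Fin n) (Fin n) ℝ) :
    degMatrix M * meanProj n = M * meanProj n := by
  ext i j
  simp [degMatrix, meanProj, deg, Matrix.mul_apply, Matrix.diagonal_apply, Finset.sum_mul]

lemma gradMatrix_eq (C : Matrix (Fin n) (Fin n) ℝ) (w : Emb n) :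
    gradMatrix C w = degMatrix C * (softmaxMatrix w - meanProj n) - C * (1 - meanProj n) := by
  rw [gradMatrix, mul_sub, mul_sub, degMatrix_mul_meanProj, mul_one]
  abel

lemma mul_one_sub_meanProj {σ : Fin n → Fin K} (hσ : Balanced σ) (hK : 0 < K) (hn : 0 < n)
    {p q : ℝ} (hs : 0 < p + ((K : ℝ) - 1) * q) (L T : ℕ) (R : Matrix (Fin n) (Fin n) ℝ) :
    (expectedCoOccurrence L T σ p q + R) * (1 - meanProj n) =
      (communityWeight K L T p q / n) • communityProj σ + R * (1 - meanProj n) := by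
  rw [add_mul, expectedCoOccurrence_eq hσ hK hn hs, add_mul]
  congr 1
  simp only [mul_sub, mul_one, smul_mul_assoc, meanProj_mul_self hn,
    communityProj_mul_meanProj hσ hK hn, smul_zero]
  simp

/-- A row sum is a coordinate of `R 𝟏`, and `‖𝟏‖ = √n`. -/
lemma abs_deg_le (R : Matrix (Fin n) (Fin n) ℝ) (i : Fin n) : |deg R i| ≤ ‖R‖ * √n := by
  have h := l2_opNorm_mulVec R (WithLp.toLp 2 fun _ => (1 : ℝ))
  have h1 : ‖(WithLp.toLp 2 fun _ => (1 : ℝ) : EuclideanSpace ℝ (Fin n))‖ = √n := by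
    simp [EuclideanSpace.norm_eq]
  rw [h1] at h
  refine le_trans ?_ h
  have h2 := PiLp.norm_apply_le
    (WithLp.toLp 2 (R *ᵥ fun _ => (1 : ℝ)) : EuclideanSpace ℝ (Fin n)) i
  simpa [Matrix.mulVec, dotProduct, deg] using h2

lemma deg_expectedCoOccurrence {σ : Fin n → Fin K} (hσ : Balanced σ) (hK : 0 < K) (hn : 0 < n)
    {p q : ℝ} (hs : 0 < p + ((K : ℝ) - 1) * q) (L T : ℕ) (i : Fin n) :
    deg (expectedCoOccurrence L T σ p q) i = walkWeight L T / n := by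
  have hn' : (n : ℝ) ≠ 0 := by positivity
  have h : expectedCoOccurrence L T σ p q * meanProj n = (walkWeight L T / n) • meanProj n := by
    rw [expectedCoOccurrence_eq hσ hK hn hs, add_mul, smul_mul_assoc, smul_mul_assoc,
      meanProj_mul_self hn, communityProj_mul_meanProj hσ hK hn, smul_zero, add_zero]
  have h2 := congrFun (congrFun h i) i
  simp only [Matrix.mul_apply, meanProj, Matrix.of_apply, Matrix.smul_apply, smul_eq_mul,
    ← Finset.sum_mul] at h2
  exact mul_right_cancel₀ (by positivity) h2

lemma norm_le_of_abs_entry_le (M : Matrix (Fin n) (Fin n) ℝ) {m : ℝ} (hm : 0 ≤ m)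
    (h : ∀ i j, |M i j| ≤ m) : ‖M‖ ≤ n * m := by
  rw [l2_opNorm_def]
  refine ContinuousLinearMap.opNorm_le_bound _ (by positivity) fun v => ?_
  refine abs_le_of_sq_le_sq' ?_ (by positivity) |>.2
  rw [mul_pow, EuclideanSpace.real_norm_sq_eq, EuclideanSpace.real_norm_sq_eq v]
  have hrow : ∀ i, (∑ j, M i j * v j) ^ 2 ≤ n * m ^ 2 * ∑ j, v j ^ 2 := by
    intro i
    refine (Finset.sum_mul_sq_le_sq_mul_sq _ _ _).trans ?_
    refine mul_le_mul_of_nonneg_right ?_ (by positivity)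
    calc ∑ j, M i j ^ 2 ≤ ∑ _j : Fin n, m ^ 2 :=
          Finset.sum_le_sum fun j _ => sq_le_sq' (by linarith [(abs_le.1 (h i j)).1])
            (abs_le.1 (h i j)).2
      _ = n * m ^ 2 := by simp
  calc _ = ∑ i, (∑ j, M i j * v j) ^ 2 := rfl
    _ ≤ ∑ _i : Fin n, n * m ^ 2 * ∑ j, v j ^ 2 := Finset.sum_le_sum fun i _ => hrow i
    _ = _ := by simp; ring

/-- Numerator and average denominator both lie in `[exp (-r), exp r]`, so each entry lies between
`exp (∓2r) / n`. The bound `r ≤ 1/2` allows `|exp u - 1| ≤ 2|u|` at `u = 2r`. -/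
lemma abs_softmaxMatrix_sub_le (w : Emb n) {r : ℝ} (hr : r ≤ 1 / 2)
    (h : ∀ i j, |xPart w i * yPart w j| ≤ r) (i j : Fin n) :
    |softmaxMatrix w i j - 1 / n| ≤ 4 * r / n := by
  have hr0 : 0 ≤ r := (abs_nonneg _).trans (h i j)
  have hn' : (0 : ℝ) < n := by exact_mod_cast i.pos
  have hlo : ∀ k, Real.exp (-r) ≤ Real.exp (xPart w i * yPart w k) := fun k =>
    Real.exp_le_exp.2 (abs_le.1 (h i k)).1
  have hhi : ∀ k, Real.exp (xPart w i * yPart w k) ≤ Real.exp r := fun k =>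
    Real.exp_le_exp.2 (abs_le.1 (h i k)).2
  have hSlo : n * Real.exp (-r) ≤ ∑ k, Real.exp (xPart w i * yPart w k) := by
    simpa using Finset.sum_le_sum fun k (_ : k ∈ Finset.univ) => hlo k
  have hShi : ∑ k, Real.exp (xPart w i * yPart w k) ≤ n * Real.exp r := by
    simpa using Finset.sum_le_sum fun k (_ : k ∈ Finset.univ) => hhi k
  have hSpos : 0 < ∑ k, Real.exp (xPart w i * yPart w k) :=
    lt_of_lt_of_le (by positivity) hSlo
  have he : Real.exp (2 * r) - 1 ≤ 4 * r := by
    have := Real.abs_exp_sub_one_le (x := 2 * r) (by rw [abs_of_nonneg] <;> linarith)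
    rw [abs_of_nonneg (by linarith : 0 ≤ 2 * r)] at this
    linarith [le_abs_self (Real.exp (2 * r) - 1)]
  have he' : 1 - 2 * r ≤ Real.exp (-(2 * r)) := by
    linarith [Real.add_one_le_exp (-(2 * r))]
  have hup : softmaxMatrix w i j ≤ Real.exp (2 * r) / n := by
    simp only [softmaxMatrix, Matrix.of_apply]
    rw [div_le_div_iff₀ hSpos hn']
    have h1 : Real.exp (2 * r) * Real.exp (-r) = Real.exp r := by
      rw [← Real.exp_add]; congr 1; ring
    calc _ ≤ Real.exp r * n := mul_le_mul_of_nonneg_right (hhi j) hn'.le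
      _ = Real.exp (2 * r) * (n * Real.exp (-r)) := by rw [← h1]; ring
      _ ≤ _ := mul_le_mul_of_nonneg_left hSlo (Real.exp_nonneg _)
  have hdn : Real.exp (-(2 * r)) / n ≤ softmaxMatrix w i j := by
    simp only [softmaxMatrix, Matrix.of_apply]
    rw [div_le_div_iff₀ hn' hSpos]
    have h1 : Real.exp (-(2 * r)) * Real.exp r = Real.exp (-r) := by
      rw [← Real.exp_add]; congr 1; ring
    calc _ ≤ Real.exp (-(2 * r)) * (n * Real.exp r) :=
          mul_le_mul_of_nonneg_left hShi (Real.exp_nonneg _)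
      _ = Real.exp (-r) * n := by rw [← h1]; ring
      _ ≤ _ := mul_le_mul_of_nonneg_right (hlo j) hn'.le
  rw [abs_le]
  constructor
  · calc -(4 * r / n) ≤ (1 - 2 * r) / n - 1 / n := by
          rw [← sub_div, ← neg_div]; gcongr; linarith
      _ ≤ Real.exp (-(2 * r)) / n - 1 / n := by gcongr
      _ ≤ _ := by linarith
  · calc _ ≤ Real.exp (2 * r) / n - 1 / n := by linarith
      _ ≤ 4 * r / n := by rw [← sub_div]; gcongr

lemma norm_sq_eq_xPart_add_yPart (w : Emb n) : ‖w‖ ^ 2 = ‖xPart w‖ ^ 2 + ‖yPart w‖ ^ 2 := by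
  simp only [EuclideanSpace.real_norm_sq_eq, Fintype.sum_sum_type]
  rfl

lemma norm_xPart_le (w : Emb n) : ‖xPart w‖ ≤ ‖w‖ := by
  refine abs_le_of_sq_le_sq' ?_ (norm_nonneg _) |>.2
  nlinarith [norm_sq_eq_xPart_add_yPart w, sq_nonneg ‖yPart w‖]

lemma norm_yPart_le (w : Emb n) : ‖yPart w‖ ≤ ‖w‖ := by
  refine abs_le_of_sq_le_sq' ?_ (norm_nonneg _) |>.2
  nlinarith [norm_sq_eq_xPart_add_yPart w, sq_nonneg ‖xPart w‖]

lemma norm_degMatrix_mul_softmax_sub_le {C : Matrix (Fin n) (Fin n) ℝ} {D : ℝ} (hD0 : 0 ≤ D)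
    (hD : ∀ i, |deg C i| ≤ D) (w : Emb n) {r : ℝ} (hr : r ≤ 1 / 2) (hw : ‖w‖ ^ 2 ≤ r) :
    ‖degMatrix C * (softmaxMatrix w - meanProj n)‖ ≤ 4 * D * r := by
  have hr0 : 0 ≤ r := (sq_nonneg _).trans hw
  have hent : ∀ i j, |xPart w i * yPart w j| ≤ r := by
    intro i j
    have h1 : |xPart w i| ≤ ‖w‖ := (PiLp.norm_apply_le (xPart w) i).trans (norm_xPart_le w)
    have h2 : |yPart w j| ≤ ‖w‖ := (PiLp.norm_apply_le (yPart w) j).trans (norm_yPart_le w)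
    rw [abs_mul]
    calc _ ≤ ‖w‖ * ‖w‖ := mul_le_mul h1 h2 (abs_nonneg _) (norm_nonneg _)
      _ ≤ r := by rwa [← sq]
  rcases Nat.eq_zero_or_pos n with rfl | hn
  · have : degMatrix C * (softmaxMatrix w - meanProj 0) = 0 := Subsingleton.elim _ _
    rw [this, norm_zero]; positivity
  have hn' : (0 : ℝ) < n := by exact_mod_cast hn
  calc _ ≤ n * (D * (4 * r / n)) := by
        refine norm_le_of_abs_entry_le _ (by positivity) fun i j => ?_
        rw [degMatrix, Matrix.diagonal_mul, abs_mul]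
        exact mul_le_mul (hD i) (abs_softmaxMatrix_sub_le w hr hent i j) (abs_nonneg _) hD0
    _ = 4 * D * r := by field_simp

/-! ### The symmetric dilation and its growing eigenvector -/

/-- The symmetric dilation `[[0, M], [Mᵀ, 0]]`. -/
def dilation (M : Matrix (Fin n) (Fin n) ℝ) : Matrix (Fin n ⊕ Fin n) (Fin n ⊕ Fin n) ℝ :=
  Matrix.fromBlocks 0 M Mᵀ 0

lemma dilation_sub (M N : Matrix (Fin n) (Fin n) ℝ) :
    dilation (M - N) = dilation M - dilation N := by
  simp [dilation, sub_eq_add_neg, Matrix.fromBlocks_neg, Matrix.fromBlocks_add]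

lemma xPart_dilation (M : Matrix (Fin n) (Fin n) ℝ) (w : Emb n) :
    xPart (toEuclideanCLM (𝕜 := ℝ) (dilation M) w) = toEuclideanCLM (𝕜 := ℝ) M (yPart w) := by
  ext i
  simp [xPart, yPart, dilation, Matrix.fromBlocks_mulVec, ofLp_toEuclideanCLM]
  rfl

lemma yPart_dilation (M : Matrix (Fin n) (Fin n) ℝ) (w : Emb n) :
    yPart (toEuclideanCLM (𝕜 := ℝ) (dilation M) w) = toEuclideanCLM (𝕜 := ℝ) Mᵀ (xPart w) := by
  ext i
  simp [xPart, yPart, dilation, Matrix.fromBlocks_mulVec, ofLp_toEuclideanCLM]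
  rfl

lemma gdStep_eq (C : Matrix (Fin n) (Fin n) ℝ) (η : ℝ) (w : Emb n) :
    gdStep C η w = w - η • toEuclideanCLM (𝕜 := ℝ) (dilation (gradMatrix C w)) w := by
  have h : Matrix.fromBlocks 1 (-(η • gradMatrix C w)) (-(η • (gradMatrix C w)ᵀ)) 1 =
      1 - η • dilation (gradMatrix C w) := by
    simp [dilation, sub_eq_add_neg, Matrix.fromBlocks_neg, Matrix.fromBlocks_smul,
      Matrix.fromBlocks_add, ← Matrix.fromBlocks_one]
  rw [gdStep, h, Matrix.sub_mulVec, Matrix.one_mulVec, Matrix.smul_mulVec]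
  rfl

lemma xPart_gdStep (C : Matrix (Fin n) (Fin n) ℝ) (η : ℝ) (w : Emb n) :
    xPart (gdStep C η w) =
      xPart w - η • toEuclideanCLM (𝕜 := ℝ) (gradMatrix C w) (yPart w) := by
  rw [gdStep_eq, ← xPart_dilation]
  rfl

lemma yPart_gdStep (C : Matrix (Fin n) (Fin n) ℝ) (η : ℝ) (w : Emb n) :
    yPart (gdStep C η w) =
      yPart w - η • toEuclideanCLM (𝕜 := ℝ) (gradMatrix C w)ᵀ (xPart w) := by
  rw [gdStep_eq, ← yPart_dilation]
  rfl

lemma norm_toEuclideanCLM_le {ι : Type*} [Fintype ι] [DecidableEq ι] (M : Matrix ι ι ℝ)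
    (x : EuclideanSpace ℝ ι) : ‖toEuclideanCLM (𝕜 := ℝ) M x‖ ≤ ‖M‖ * ‖x‖ :=
  (toEuclideanCLM (𝕜 := ℝ) M).le_opNorm x

lemma norm_transpose_eq (M : Matrix (Fin n) (Fin n) ℝ) : ‖Mᵀ‖ = ‖M‖ := by
  rw [← conjTranspose_eq_transpose_of_trivial, l2_opNorm_conjTranspose]

lemma norm_dilation_le (M : Matrix (Fin n) (Fin n) ℝ) (w : Emb n) :
    ‖toEuclideanCLM (𝕜 := ℝ) (dilation M) w‖ ≤ ‖M‖ * ‖w‖ := by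
  refine abs_le_of_sq_le_sq' ?_ (by positivity) |>.2
  rw [norm_sq_eq_xPart_add_yPart, xPart_dilation, yPart_dilation, mul_pow,
    norm_sq_eq_xPart_add_yPart w]
  have h1 := norm_toEuclideanCLM_le M (yPart w)
  have h2 := norm_toEuclideanCLM_le Mᵀ (xPart w)
  rw [norm_transpose_eq] at h2
  have h3 := pow_le_pow_left₀ (norm_nonneg _) h1 2
  have h4 := pow_le_pow_left₀ (norm_nonneg _) h2 2
  rw [mul_pow] at h3 h4
  linarith

lemma inner_toEuclideanCLM_left {ι : Type*} [Fintype ι] [DecidableEq ι] (M : Matrix ι ι ℝ)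
    (x y : EuclideanSpace ℝ ι) :
    inner ℝ (toEuclideanCLM (𝕜 := ℝ) M x) y = inner ℝ x (toEuclideanCLM (𝕜 := ℝ) Mᵀ y) := by
  rw [← conjTranspose_eq_transpose_of_trivial, ← star_eq_conjTranspose, map_star,
    ContinuousLinearMap.star_eq_adjoint, ContinuousLinearMap.adjoint_inner_right]

lemma dilation_transpose (M : Matrix (Fin n) (Fin n) ℝ) : (dilation M)ᵀ = dilation M := by
  simp [dilation, Matrix.fromBlocks_transpose]

/-- A symmetric operator has an eigenvalue at least as large as any of its Rayleigh quotients. -/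
lemma exists_eigenvector_ge {E : Type*} [NormedAddCommGroup E] [InnerProductSpace ℝ E]
    [FiniteDimensional ℝ E] (T : E →L[ℝ] E) (hT : (T : E →ₗ[ℝ] E).IsSymmetric) {u : E}
    (hu : u ≠ 0) {l : ℝ} (hl : l * ‖u‖ ^ 2 ≤ inner ℝ (T u) u) :
    ∃ (v : E) (a : ℝ), ‖v‖ = 1 ∧ l ≤ a ∧ T v = a • v := by
  have : Nontrivial E := ⟨u, 0, hu⟩
  have hev := hT.hasEigenvalue_iSup_of_finiteDimensional
  obtain ⟨v, hv⟩ := hev.exists_hasEigenvector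
  set a : ℝ := ⨆ x : { x : E // x ≠ 0 },
    RCLike.re (inner ℝ ((T : E →ₗ[ℝ] E) x) (x : E)) / ‖(x : E)‖ ^ 2
  have hv0 : ‖v‖ ≠ 0 := norm_ne_zero_iff.2 hv.2
  have hTv : T v = a • v := hv.apply_eq_smul
  refine ⟨‖v‖⁻¹ • v, a, ?_, ?_, ?_⟩
  · rw [norm_smul, norm_inv, norm_norm, inv_mul_cancel₀ hv0]
  · have hbdd : BddAbove (Set.range fun x : { x : E // x ≠ 0 } =>
        RCLike.re (inner ℝ ((T : E →ₗ[ℝ] E) x) (x : E)) / ‖(x : E)‖ ^ 2) := by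
      refine ⟨‖T‖, ?_⟩
      rintro _ ⟨x, rfl⟩
      have hx : 0 < ‖(x : E)‖ := norm_pos_iff.2 x.2
      dsimp only
      rw [div_le_iff₀ (by positivity)]
      calc _ ≤ ‖T x‖ * ‖(x : E)‖ := real_inner_le_norm _ _
        _ ≤ ‖T‖ * ‖(x : E)‖ * ‖(x : E)‖ := by gcongr; exact T.le_opNorm _
        _ = _ := by ring
    refine le_trans ?_ (le_ciSup hbdd ⟨u, hu⟩)
    have hu' : 0 < ‖u‖ := norm_pos_iff.2 hu
    dsimp only
    rw [le_div_iff₀ (by positivity)]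
    exact hl
  · rw [map_smul, hTv, smul_comm]

/-- Any column of the projection is fixed by it, and the diagonal entry `(K - 1) / n` shows that the
column is nonzero. -/
lemma exists_communityProj_fixed {σ : Fin n → Fin K} (hσ : Balanced σ) (hK : 2 ≤ K) (hn : 0 < n) :
    ∃ u : EuclideanSpace ℝ (Fin n), u ≠ 0 ∧ toEuclideanCLM (𝕜 := ℝ) (communityProj σ) u = u := by
  have hn' : (0 : ℝ) < n := by exact_mod_cast hn
  have hK' : (2 : ℝ) ≤ K := by exact_mod_cast hK
  let i : Fin n := ⟨0, hn⟩
  refine ⟨toEuclideanCLM (𝕜 := ℝ) (communityProj σ) (EuclideanSpace.single i 1), fun h => ?_, ?_⟩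
  · have h2 : communityProj σ i i = 0 := by
      have := congrArg (fun v : EuclideanSpace ℝ (Fin n) => v i) h
      simpa [ofLp_toEuclideanCLM] using this
    simp only [communityProj, clusterProj, meanProj, Matrix.sub_apply, Matrix.of_apply, if_true,
      ← sub_div] at h2
    rw [div_eq_zero_iff] at h2
    rcases h2 with h2 | h2 <;> linarith
  · rw [← mul_apply_eq_comp, ← map_mul, communityProj_mul_self hσ (by omega) hn]

/-- The test vector `(u, u)` with `u` fixed by `communityProj σ` has Rayleigh quotient `b + ⟨u, R u⟩
/ ‖u‖²`, at least `b - ‖R‖`. -/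
lemma exists_dilation_eigenvector {σ : Fin n → Fin K} (hσ : Balanced σ) (hK : 2 ≤ K) (hn : 0 < n)
    (b : ℝ) (R : Matrix (Fin n) (Fin n) ℝ) :
    ∃ (v : Emb n) (a : ℝ), ‖v‖ = 1 ∧ b - ‖R‖ ≤ a ∧
      toEuclideanCLM (𝕜 := ℝ) (dilation (b • communityProj σ + R)) v = a • v := by
  obtain ⟨u, hu, hZu⟩ := exists_communityProj_fixed hσ hK hn
  let w : Emb n := WithLp.toLp 2 (Sum.elim u u)
  have hx : xPart w = u := rfl
  have hy : yPart w = u := rfl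
  have hw : w ≠ 0 := by
    intro h
    apply hu
    rw [← hx, h]; rfl
  have hinner : ∀ a b : Emb n, inner ℝ a b =
      inner ℝ (xPart a) (xPart b) + inner ℝ (yPart a) (yPart b) := by
    intro a b
    simp only [PiLp.inner_apply, Fintype.sum_sum_type]
    rfl
  refine exists_eigenvector_ge _ ?_ hw ?_
  · intro x y
    have := inner_toEuclideanCLM_left (dilation (b • communityProj σ + R)) x y
    rw [dilation_transpose] at this
    exact this
  · rw [hinner, xPart_dilation, yPart_dilation, hx, hy, norm_sq_eq_xPart_add_yPart,
      hx, hy, inner_toEuclideanCLM_left, inner_toEuclideanCLM_left, transpose_transpose]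
    have h1 : inner ℝ u (toEuclideanCLM (𝕜 := ℝ) (b • communityProj σ + R) u) =
        b * ‖u‖ ^ 2 + inner ℝ u (toEuclideanCLM (𝕜 := ℝ) R u) := by
      rw [map_add, map_smul, _root_.add_apply, _root_.smul_apply, hZu,
        inner_add_right, inner_smul_right, real_inner_self_eq_norm_sq]
    have h2 : |inner ℝ u (toEuclideanCLM (𝕜 := ℝ) R u)| ≤ ‖R‖ * ‖u‖ ^ 2 := by
      calc _ ≤ ‖u‖ * ‖toEuclideanCLM (𝕜 := ℝ) R u‖ := abs_real_inner_le_norm _ _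
        _ ≤ ‖u‖ * (‖R‖ * ‖u‖) := by gcongr; exact norm_toEuclideanCLM_le R u
        _ = _ := by ring
    have h3 : inner ℝ u (toEuclideanCLM (𝕜 := ℝ) (b • communityProj σ + R)ᵀ u) =
        inner ℝ u (toEuclideanCLM (𝕜 := ℝ) (b • communityProj σ + R) u) := by
      rw [← inner_toEuclideanCLM_left, real_inner_comm]
    have := (abs_le.1 h2).1
    rw [h3, h1]
    nlinarith

/-! ### Cluster means as a projection -/

lemma meanVec_eq {σ : Fin n → Fin K} (hσ : Balanced σ) (hK : 0 < K)
    (x : EuclideanSpace ℝ (Fin n)) :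
    meanVec σ x = toEuclideanCLM (𝕜 := ℝ) (clusterProj σ) x := by
  ext j
  simp only [meanVec, ofLp_toEuclideanCLM, Matrix.mulVec, dotProduct, clusterProj, Matrix.of_apply,
    card_cluster hσ hK, Finset.sum_filter, Finset.sum_div]
  refine Finset.sum_congr rfl fun r _ => ?_
  by_cases h : σ r = σ j
  · rw [if_pos h, if_pos h.symm, div_div_eq_mul_div]; ring
  · rw [if_neg h, if_neg (Ne.symm h)]; simp

lemma sub_meanVec_eq {σ : Fin n → Fin K} (hσ : Balanced σ) (hK : 0 < K)
    (x : EuclideanSpace ℝ (Fin n)) :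
    x - meanVec σ x = toEuclideanCLM (𝕜 := ℝ) (1 - clusterProj σ) x := by
  rw [meanVec_eq hσ hK, map_sub, map_one, _root_.sub_apply,
    one_apply_eq_self]

lemma norm_sub_meanVec_le {σ : Fin n → Fin K} (hσ : Balanced σ) (hK : 0 < K) (hn : 0 < n)
    (x : EuclideanSpace ℝ (Fin n)) : ‖x - meanVec σ x‖ ≤ ‖x‖ := by
  rw [sub_meanVec_eq hσ hK]
  refine (norm_toEuclideanCLM_le _ _).trans (mul_le_of_le_one_left (norm_nonneg _) ?_)
  exact norm_one_sub_le_one (clusterProj_isSymm σ) (clusterProj_mul_self hσ hK hn)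

/-! ### One step of gradient descent -/

/-- The dominant part of the gradient maps into cluster-constant vectors, which `1 - clusterProj σ`
annihilates, so only `E` moves the deviation from the means. -/
lemma norm_sub_meanVec_gdStep_le {σ : Fin n → Fin K} (hσ : Balanced σ) (hK : 0 < K) (hn : 0 < n)
    {C : Matrix (Fin n) (Fin n) ℝ} {η : ℝ} (hη : 0 ≤ η) {w : Emb n} {b : ℝ}
    {E : Matrix (Fin n) (Fin n) ℝ} (hG : gradMatrix C w = E - b • communityProj σ) :
    ‖xPart (gdStep C η w) - meanVec σ (xPart (gdStep C η w))‖ ≤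
      ‖xPart w - meanVec σ (xPart w)‖ + η * ‖E‖ * ‖w‖ := by
  have h0 : (1 - clusterProj σ) * gradMatrix C w = (1 - clusterProj σ) * E := by
    rw [hG, mul_sub, mul_smul_comm, one_sub_clusterProj_mul_communityProj hσ hK hn, smul_zero,
      sub_zero]
  rw [sub_meanVec_eq hσ hK, sub_meanVec_eq hσ hK, xPart_gdStep, map_sub, map_smul,
    ← mul_apply_eq_comp, ← map_mul, h0, map_mul, mul_apply_eq_comp]
  refine (norm_sub_le _ _).trans (add_le_add_right ?_ _)
  rw [norm_smul, Real.norm_of_nonneg hη, mul_assoc]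
  refine mul_le_mul_of_nonneg_left ?_ hη
  calc _ ≤ ‖1 - clusterProj σ‖ * ‖toEuclideanCLM (𝕜 := ℝ) E (yPart w)‖ :=
        norm_toEuclideanCLM_le _ _
    _ ≤ 1 * (‖E‖ * ‖w‖) := by
        refine mul_le_mul ?_ ?_ (norm_nonneg _) zero_le_one
        · exact norm_one_sub_le_one (clusterProj_isSymm σ) (clusterProj_mul_self hσ hK hn)
        · refine (norm_toEuclideanCLM_le _ _).trans ?_
          gcongr
          exact norm_yPart_le w
    _ = _ := one_mul _

lemma norm_xPart_sub_yPart_gdStep_le {σ : Fin n → Fin K} (hσ : Balanced σ) (hK : 0 < K)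
    (hn : 0 < n) {C : Matrix (Fin n) (Fin n) ℝ} {η : ℝ} (hη : 0 ≤ η) {w : Emb n} {b : ℝ}
    (hb0 : 0 ≤ η * b) (hb1 : η * b ≤ 1)
    {E : Matrix (Fin n) (Fin n) ℝ} (hG : gradMatrix C w = E - b • communityProj σ) :
    ‖xPart (gdStep C η w) - yPart (gdStep C η w)‖ ≤
      ‖xPart w - yPart w‖ + 2 * (η * ‖E‖ * ‖w‖) := by
  have hGt : (gradMatrix C w)ᵀ = Eᵀ - b • communityProj σ := by
    rw [hG, transpose_sub, transpose_smul, communityProj_isSymm]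
  -- The community part acts on `x - y` as `1 - ηb Z`, a convex combination of `1` and `1 - Z`,
  -- hence a contraction; this is where `ηb ≤ 1` is needed.
  have heq : xPart (gdStep C η w) - yPart (gdStep C η w) =
      ((1 - η * b) • (xPart w - yPart w) +
        (η * b) • toEuclideanCLM (𝕜 := ℝ) (1 - communityProj σ) (xPart w - yPart w)) -
      (η • toEuclideanCLM (𝕜 := ℝ) E (yPart w) - η • toEuclideanCLM (𝕜 := ℝ) Eᵀ (xPart w)) := by
    rw [xPart_gdStep, yPart_gdStep, hGt, hG]
    simp only [map_sub, map_smul, map_one, _root_.sub_apply,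
      _root_.smul_apply, one_apply_eq_self]
    module
  rw [heq]
  have h1 : ‖(1 - η * b) • (xPart w - yPart w) +
        (η * b) • toEuclideanCLM (𝕜 := ℝ) (1 - communityProj σ) (xPart w - yPart w)‖ ≤
      ‖xPart w - yPart w‖ := by
    refine (norm_add_le _ _).trans ?_
    rw [norm_smul, norm_smul, Real.norm_of_nonneg hb0, Real.norm_of_nonneg (sub_nonneg.2 hb1)]
    have h2 : ‖toEuclideanCLM (𝕜 := ℝ) (1 - communityProj σ) (xPart w - yPart w)‖ ≤
        ‖xPart w - yPart w‖ :=
      (norm_toEuclideanCLM_le _ _).trans (mul_le_of_le_one_left (norm_nonneg _)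
        (norm_one_sub_le_one (communityProj_isSymm σ) (communityProj_mul_self hσ hK hn)))
    nlinarith
  have h3 : ‖toEuclideanCLM (𝕜 := ℝ) E (yPart w)‖ ≤ ‖E‖ * ‖w‖ :=
    (norm_toEuclideanCLM_le _ _).trans (by gcongr; exact norm_yPart_le w)
  have h4 : ‖toEuclideanCLM (𝕜 := ℝ) Eᵀ (xPart w)‖ ≤ ‖E‖ * ‖w‖ := by
    rw [← norm_transpose_eq E]
    exact (norm_toEuclideanCLM_le _ _).trans (by gcongr; exact norm_xPart_le w)
  refine (norm_sub_le _ _).trans (add_le_add h1 ((norm_sub_le _ _).trans ?_))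
  rw [norm_smul, norm_smul, Real.norm_of_nonneg hη]
  nlinarith [mul_le_mul_of_nonneg_left h3 hη, mul_le_mul_of_nonneg_left h4 hη]

/-- The dilation of `H` is symmetric, so it acts on the `v`-component as multiplication by `a`. In
the application `H` contains the perturbation `R`, so `F` is the softmax error only. -/
lemma abs_inner_gdStep_ge {C : Matrix (Fin n) (Fin n) ℝ} {η : ℝ} (hη : 0 ≤ η) {w v : Emb n}
    (hv : ‖v‖ = 1) {l a : ℝ} (hl : 0 ≤ l) (hla : l ≤ a) {H F : Matrix (Fin n) (Fin n) ℝ}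
    (hH : toEuclideanCLM (𝕜 := ℝ) (dilation H) v = a • v) (hG : gradMatrix C w = F - H) :
    (1 + η * l) * |inner ℝ v w| - η * ‖F‖ * ‖w‖ ≤ |inner ℝ v (gdStep C η w)| := by
  have h1 : inner ℝ v (toEuclideanCLM (𝕜 := ℝ) (dilation H) w) = a * inner ℝ v w := by
    have := inner_toEuclideanCLM_left (dilation H) v w
    rw [dilation_transpose] at this
    rw [← this, hH, real_inner_smul_left]
  have h2 : inner ℝ v (gdStep C η w) = (1 + η * a) * inner ℝ v w -
      η * inner ℝ v (toEuclideanCLM (𝕜 := ℝ) (dilation F) w) := by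
    rw [gdStep_eq, hG, dilation_sub, map_sub, _root_.sub_apply, inner_sub_right,
      real_inner_smul_right, inner_sub_right, h1]
    ring
  have h3 : |η * inner ℝ v (toEuclideanCLM (𝕜 := ℝ) (dilation F) w)| ≤ η * ‖F‖ * ‖w‖ := by
    rw [abs_mul, abs_of_nonneg hη, mul_assoc]
    refine mul_le_mul_of_nonneg_left ?_ hη
    refine (abs_real_inner_le_norm _ _).trans ?_
    rw [hv, one_mul]
    exact norm_dilation_le F w
  have h4 : (1 + η * l) * |inner ℝ v w| ≤ |(1 + η * a) * inner ℝ v w| := by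
    have h5 : 0 ≤ η * a := mul_nonneg hη (hl.trans hla)
    rw [abs_mul, abs_of_nonneg (by linarith : 0 ≤ 1 + η * a)]
    gcongr
  rw [h2]
  linarith [abs_sub_abs_le_abs_sub ((1 + η * a) * inner ℝ v w)
    (η * inner ℝ v (toEuclideanCLM (𝕜 := ℝ) (dilation F) w))]

/-! ### Growth until the stopping time -/

/-- A sequence `N` dominating a geometrically growing sequence `α` reaches the level `W`; errors
`h`, `d` which grow by at most a constant in each step stay controlled until then. -/
lemma exists_stopping_time {N h d α : ℕ → ℝ} {W l ν e : ℝ} {m : ℕ} (hl : 0 ≤ l)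
    (he : 0 ≤ e) (hαN : ∀ t, α t ≤ N t) (hN0 : N 0 < W)
    (hα : ∀ t, N t < W → (1 + l) * α t - l * ν ≤ α (t + 1))
    (hh : ∀ t, N t < W → h (t + 1) ≤ h t + e)
    (hd : ∀ t, N t < W → d (t + 1) ≤ d t + 2 * e)
    (hν : 0 ≤ ν) (hm : W ≤ (1 + l) ^ m * (α 0 - ν)) :
    ∃ tf, IsLeast {t : ℕ | 1 ≤ t ∧ W ≤ N t} tf ∧ h tf ≤ h 0 + m * e ∧ d tf ≤ d 0 + 2 * (m * e) := by
  -- Subtracting the fixed point `ν` turns `(1 + l) α - l ν` into pure geometric growth of `α - ν`.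
  have key : ∀ t, (∀ s < t, N s < W) → (1 + l) ^ t * (α 0 - ν) ≤ α t - ν ∧
      h t ≤ h 0 + t * e ∧ d t ≤ d 0 + 2 * (t * e) := by
    intro t
    induction t with
    | zero => intro _; simp
    | succ t ih =>
      intro hs
      obtain ⟨h1, h2, h3⟩ := ih fun s hst => hs s (by omega)
      have hNt := hs t (by omega)
      refine ⟨?_, ?_, ?_⟩
      · have := mul_le_mul_of_nonneg_left h1 (by linarith : 0 ≤ 1 + l)
        rw [pow_succ', mul_assoc]
        nlinarith [hα t hNt]
      · push_cast; linarith [hh t hNt]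
      · push_cast; linarith [hd t hNt]
  have hex : ∃ t, W ≤ N t ∧ t ≤ m := by
    by_contra hcon
    push Not at hcon
    have hlt : ∀ s ≤ m, N s < W := fun s hs => by
      by_contra hW
      exact absurd (hcon s (not_lt.1 hW)) (by omega)
    have := (key m fun s hs => hlt s hs.le).1
    linarith [hlt m le_rfl, hαN m]
  classical
  have hex' : ∃ t, W ≤ N t := hex.imp fun t ht => ht.1
  have hmin : ∀ s < Nat.find hex', N s < W := fun s hs => not_le.1 (Nat.find_min hex' hs)
  have hle : Nat.find hex' ≤ m := by
    obtain ⟨t, ht, htm⟩ := hex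
    exact (Nat.find_min' hex' ht).trans htm
  have hle' : (Nat.find hex' : ℝ) * e ≤ m * e := by gcongr
  obtain ⟨-, h2, h3⟩ := key _ hmin
  refine ⟨Nat.find hex', ⟨⟨?_, Nat.find_spec hex'⟩, fun t ht => Nat.find_min' hex' ht.2⟩,
    by linarith, by linarith⟩
  by_contra h0
  have h0' : Nat.find hex' = 0 := by omega
  have := Nat.find_spec hex'
  rw [h0'] at this
  linarith

lemma norm_le_two_mul_norm_xPart_add (w : Emb n) :
    ‖w‖ ≤ 2 * ‖xPart w‖ + ‖xPart w - yPart w‖ := by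
  have h1 : ‖yPart w‖ ≤ ‖xPart w‖ + ‖xPart w - yPart w‖ := by
    have := norm_sub_le (xPart w) (xPart w - yPart w)
    rwa [sub_sub_cancel] at this
  have h2 : ‖w‖ ≤ ‖xPart w‖ + ‖yPart w‖ := by
    refine abs_le_of_sq_le_sq' ?_ (by positivity) |>.2
    nlinarith [norm_sq_eq_xPart_add_yPart w, norm_nonneg (xPart w), norm_nonneg (yPart w),
      mul_nonneg (norm_nonneg (xPart w)) (norm_nonneg (yPart w))]
  linarith

/-- Gradient descent started with overlap `a₀` with the top eigenvector `v` of the linearized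
dynamics stops, and its output is nearly constant on clusters. -/
lemma descent_recovers {σ : Fin n → Fin K} (hσ : Balanced σ) (hK : 0 < K) (hn : 0 < n)
    {p q : ℝ} (hs : 0 < p + ((K : ℝ) - 1) * q) {L T : ℕ} {C R : Matrix (Fin n) (Fin n) ℝ}
    (hC : C = expectedCoOccurrence L T σ p q + R)
    {η D f e l a a₀ : ℝ} {m : ℕ} {v : Emb n} {g : Fin n ⊕ Fin n → ℝ}
    (hη : 0 ≤ η) (hΔ : 15 ≤ Del n) (hε : 0 < eps n) (hε0 : ‖initVec g‖ = eps n)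
    (hW : (eps n * Del n) ^ 2 ≤ 1 / 2)
    (hD : |walkWeight L T / n| + ‖R‖ * √n ≤ D) (hf : 4 * D * (eps n * Del n) ^ 2 ≤ f)
    (he : ‖R‖ + f ≤ e) (hl : 0 ≤ l) (hla : l ≤ a)
    (hs0 : 0 ≤ communityWeight K L T p q / n) (hs1 : η * (communityWeight K L T p q / n) ≤ 1)
    (hv : ‖v‖ = 1) (hva : toEuclideanCLM (𝕜 := ℝ) (dilation (C * (1 - meanProj n))) v = a • v)
    (ha₀ : 0 ≤ a₀) (hg : a₀ ≤ |inner ℝ v (initVec g)|)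
    (hfa : f * (eps n * Del n) ≤ l * (a₀ / 2))
    (hm : eps n * Del n ≤ (1 + η * l) ^ m * (a₀ / 2))
    (hme : m * (η * e * (eps n * Del n)) ≤ eps n / 2) :
    ∃ tf : ℕ, StopsAt C η g tf ∧
      ‖xPart (iterate C η g tf) - meanVec σ (xPart (iterate C η g tf))‖ ≤
        5 * ‖xPart (iterate C η g tf)‖ / Del n := by
  set W := eps n * Del n with hWdef
  set b := communityWeight K L T p q / n with hb
  have hW0 : 0 < W := mul_pos hε (by linarith)
  have hD0 : 0 ≤ D := le_trans (by positivity) hD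
  have hf0 : 0 ≤ f := le_trans (by positivity) hf
  have he0 : 0 ≤ e := le_trans (by positivity) he
  have hdeg : ∀ i, |deg C i| ≤ D := by
    intro i
    have h1 : deg C i = walkWeight L T / n + deg R i := by
      rw [hC, ← deg_expectedCoOccurrence hσ hK hn hs L T i]
      simp [deg, Finset.sum_add_distrib]
    rw [h1]
    exact (abs_add_le _ _).trans ((add_le_add_right (abs_deg_le R i) _).trans hD)
  have hH : C * (1 - meanProj n) = b • communityProj σ + R * (1 - meanProj n) := by
    rw [hC, mul_one_sub_meanProj hσ hK hn hs]
  have hR' : ‖R * (1 - meanProj n)‖ ≤ ‖R‖ :=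
    (norm_mul_le _ _).trans (mul_le_of_le_one_right (norm_nonneg _)
      (norm_one_sub_le_one meanProj_isSymm (meanProj_mul_self hn)))
  have hF : ∀ w : Emb n, ‖w‖ < W →
      ‖degMatrix C * (softmaxMatrix w - meanProj n)‖ ≤ f := fun w hw =>
    (norm_degMatrix_mul_softmax_sub_le hD0 hdeg w hW
      (pow_le_pow_left₀ (norm_nonneg _) hw.le 2)).trans hf
  have hE : ∀ w : Emb n, ‖w‖ < W → ‖degMatrix C * (softmaxMatrix w - meanProj n) -
      R * (1 - meanProj n)‖ ≤ e := fun w hw =>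
    (norm_sub_le _ _).trans (by linarith [hF w hw])
  have hGE : ∀ w : Emb n, gradMatrix C w = (degMatrix C * (softmaxMatrix w - meanProj n) -
      R * (1 - meanProj n)) - b • communityProj σ := by
    intro w
    rw [gradMatrix_eq, hH]
    abel
  have hstep : ∀ t, iterate C η g (t + 1) = gdStep C η (iterate C η g t) := fun t =>
    Function.iterate_succ_apply' _ _ _
  have h0 : iterate C η g 0 = initVec g := rfl
  have hbound : ∀ t, ‖iterate C η g t‖ < W → ∀ M : Matrix (Fin n) (Fin n) ℝ, ∀ B : ℝ, ‖M‖ ≤ B →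
      η * ‖M‖ * ‖iterate C η g t‖ ≤ η * B * W := by
    intro t ht M B hMB
    have hB : 0 ≤ B := (norm_nonneg _).trans hMB
    gcongr
  obtain ⟨tf, htf, hh, hd⟩ := exists_stopping_time
    (N := fun t => ‖iterate C η g t‖)
    (h := fun t => ‖xPart (iterate C η g t) - meanVec σ (xPart (iterate C η g t))‖)
    (d := fun t => ‖xPart (iterate C η g t) - yPart (iterate C η g t)‖)
    (α := fun t => |inner ℝ v (iterate C η g t)|)
    (W := W) (l := η * l) (ν := a₀ / 2) (e := η * e * W) (m := m)
    (mul_nonneg hη hl) (by positivity)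
    (fun t => by
      refine (abs_real_inner_le_norm _ _).trans ?_
      rw [hv, one_mul])
    (by
      rw [h0, hε0]
      nlinarith)
    (fun t ht => by
      have h1 := abs_inner_gdStep_ge (C := C) hη (w := iterate C η g t) hv hl hla hva
        (gradMatrix_eq C _)
      have h2 := hbound t ht _ _ (hF _ ht)
      rw [hstep]
      have h3 := mul_le_mul_of_nonneg_left hfa hη
      linarith)
    (fun t ht => by
      have h1 := norm_sub_meanVec_gdStep_le hσ hK hn hη (hGE (iterate C η g t))
      have h2 := hbound t ht _ _ (hE _ ht)
      rw [hstep]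
      linarith)
    (fun t ht => by
      have h1 := norm_xPart_sub_yPart_gdStep_le hσ hK hn hη (mul_nonneg hη hs0) hs1
        (hGE (iterate C η g t))
      have h2 := hbound t ht _ _ (hE _ ht)
      rw [hstep]
      linarith)
    (by linarith)
    (by
      refine hm.trans (mul_le_mul_of_nonneg_left ?_ (by positivity))
      rw [h0]; linarith)
  refine ⟨tf, htf, ?_⟩
  simp only [h0] at hh hd
  set w := iterate C η g tf
  have hx0 : ‖xPart (initVec g) - meanVec σ (xPart (initVec g))‖ ≤ eps n :=
    (norm_sub_meanVec_le hσ hK hn _).trans ((norm_xPart_le _).trans hε0.le)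
  have hd0 : ‖xPart (initVec g) - yPart (initVec g)‖ ≤ 2 * eps n := by
    refine (norm_sub_le _ _).trans ?_
    linarith [norm_xPart_le (initVec g), norm_yPart_le (initVec g)]
  have hwW : W ≤ ‖w‖ := htf.1.2
  have hwx := norm_le_two_mul_norm_xPart_add w
  rw [le_div_iff₀ (by linarith)]
  -- Here `‖x - y‖ ≤ 2ε + ε = 3ε ≤ W/5 ≤ ‖w‖/5`, so `‖w‖ ≤ 2‖x‖ + ‖w‖/5`, which gives the factor
  -- `5/2`.
  have h15 : 15 * eps n ≤ W := by rw [hWdef]; nlinarith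
  have h5 : ‖w‖ ≤ 5 / 2 * ‖xPart w‖ := by linarith
  calc _ ≤ (3 / 2 * eps n) * Del n := by gcongr; linarith
    _ = 3 / 2 * W := by rw [hWdef]; ring
    _ ≤ 5 * ‖xPart w‖ := by linarith

/-! ### Asymptotics -/

/-- Every requirement on the size of `n`. The two with exponent `-(ρ - 1/3)/2` make `ρ = 1/3` the
threshold: one keeps the softmax error below the initial overlap, the other bounds the accumulated
drift. -/
lemma eventually_scales {ρ c δ κ η s : ℝ} (hρ : 1 / 3 < ρ) (hδ : 0 < δ) (hκ : 0 < κ) (A : ℝ) :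
    ∀ᶠ X : ℝ in Filter.atTop, 2 ≤ X ∧ 15 ≤ X ^ (1 / 6 : ℝ) ∧ c * X ^ (-(ρ / 2)) ≤ δ ∧
      4 * A * X ^ (-((ρ - 1 / 3) / 2)) ≤ δ * κ / 2 ∧ 2 / κ ≤ X ^ (1 / 3 : ℝ) ∧ η * δ ≤ X ∧
      η * s ≤ X ∧ (2 / δ * Real.log X + η) * (c + 4 * A) * X ^ (-((ρ - 1 / 3) / 2)) ≤ 1 / 2 := by
  have hι : 0 < (ρ - 1 / 3) / 2 := by linarith
  have t1 : Filter.Tendsto (fun X : ℝ => X ^ (-((ρ - 1 / 3) / 2))) Filter.atTop (nhds 0) :=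
    tendsto_rpow_neg_atTop hι
  have t2 : Filter.Tendsto (fun X : ℝ => X ^ (-(ρ / 2))) Filter.atTop (nhds 0) :=
    tendsto_rpow_neg_atTop (by linarith)
  have t3 : Filter.Tendsto (fun X : ℝ => Real.log X * X ^ (-((ρ - 1 / 3) / 2)))
      Filter.atTop (nhds 0) := by
    refine ((isLittleO_log_rpow_atTop hι).tendsto_div_nhds_zero).congr' ?_
    filter_upwards [Filter.eventually_ge_atTop 0] with X hX
    rw [Real.rpow_neg hX, div_eq_mul_inv]
  have t4 : Filter.Tendsto (fun X : ℝ =>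
      (2 / δ * Real.log X + η) * (c + 4 * A) * X ^ (-((ρ - 1 / 3) / 2)))
      Filter.atTop (nhds 0) := by
    have := (t3.const_mul (2 / δ * (c + 4 * A))).add (t1.const_mul (η * (c + 4 * A)))
    simp only [mul_zero, add_zero] at this
    refine this.congr fun X => ?_
    ring
  have t5 := t2.const_mul c
  have t6 := t1.const_mul (4 * A)
  rw [mul_zero] at t5 t6
  filter_upwards [Filter.eventually_ge_atTop 2,
    (tendsto_rpow_atTop (by norm_num : (0 : ℝ) < 1 / 6)).eventually_ge_atTop 15,
    t5.eventually_le_const hδ, t6.eventually_le_const (by positivity : 0 < δ * κ / 2),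
    (tendsto_rpow_atTop (by norm_num : (0 : ℝ) < 1 / 3)).eventually_ge_atTop (2 / κ),
    Filter.eventually_ge_atTop (η * δ), Filter.eventually_ge_atTop (η * s),
    t4.eventually_le_const (by norm_num : (0 : ℝ) < 1 / 2)] with X h1 h2 h3 h4 h5 h6 h7 h8
  exact ⟨h1, h2, h3, h4, h5, h6, h7, h8⟩

lemma le_one_add_pow {X y : ℝ} (hX : 0 < X) (hy0 : 0 < y) (hy1 : y ≤ 1) {m : ℕ}
    (hm : 2 * Real.log X / y ≤ m) : X ≤ (1 + y) ^ m := by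
  have h1 : y / 2 ≤ Real.log (1 + y) := by
    have h := Real.one_sub_inv_le_log_of_pos (by linarith : 0 < 1 + y)
    refine le_trans ?_ h
    have : 1 - (1 + y)⁻¹ = y / (1 + y) := by field_simp; ring
    rw [this]
    gcongr
    linarith
  rw [← Real.log_le_log_iff hX (by positivity), Real.log_pow]
  rw [div_le_iff₀ hy0] at hm
  nlinarith [mul_le_mul_of_nonneg_left h1 (Nat.cast_nonneg m : (0 : ℝ) ≤ m)]

lemma norm_initVec {g : Fin n ⊕ Fin n → ℝ} (hg : (WithLp.toLp 2 g : Emb n) ≠ 0) :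
    ‖initVec g‖ = eps n := by
  have h : ‖(WithLp.toLp 2 g : Emb n)‖ ≠ 0 := norm_ne_zero_iff.2 hg
  have hε : 0 ≤ eps n := by rw [eps]; positivity
  rw [initVec, norm_smul, norm_div, norm_norm, Real.norm_of_nonneg hε, div_mul_cancel₀ _ h]

lemma abs_inner_initVec_ge {v : Emb n} {g : Fin n ⊕ Fin n → ℝ} {κ B : ℝ} (hκ : 0 ≤ κ)
    (hB : 0 < B) (hn : 0 < n) (h1 : κ < |inner ℝ v (WithLp.toLp 2 g : Emb n)|)
    (h2 : ‖(WithLp.toLp 2 g : Emb n)‖ ^ 2 < 2 * n * B) :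
    κ / √(2 * B) * eps n * (n : ℝ) ^ (-(1 / 2) : ℝ) ≤ |inner ℝ v (initVec g)| := by
  have hn' : (0 : ℝ) < n := by exact_mod_cast hn
  have hε : 0 ≤ eps n := by rw [eps]; positivity
  have hg : (WithLp.toLp 2 g : Emb n) ≠ 0 := by
    intro h
    rw [h, inner_zero_right, abs_zero] at h1
    linarith
  have hg0 : 0 < ‖(WithLp.toLp 2 g : Emb n)‖ := norm_pos_iff.2 hg
  have hle : ‖(WithLp.toLp 2 g : Emb n)‖ ≤ √(2 * B) * √n := by
    rw [← Real.sqrt_mul (by positivity)]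
    exact Real.le_sqrt_of_sq_le (by linarith)
  rw [initVec, real_inner_smul_right, abs_mul, abs_of_nonneg (by positivity),
    Real.rpow_neg hn'.le, ← Real.sqrt_eq_rpow]
  calc κ / √(2 * B) * eps n * (√n)⁻¹ = eps n / (√(2 * B) * √n) * κ := by field_simp
    _ ≤ _ := by gcongr

lemma walkWeight_nonneg {L T : ℕ} (hTL : T < L) : 0 ≤ walkWeight L T := by
  refine mul_nonneg zero_le_two (Finset.sum_nonneg fun t ht => sub_nonneg.2 ?_)
  have : t ≤ L := (Finset.mem_Icc.1 ht).2.trans hTL.le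
  exact_mod_cast this

lemma eps_mul_Del (hn : 0 < n) : eps n * Del n = (n : ℝ) ^ (-(1 / 2) : ℝ) := by
  have hn' : (0 : ℝ) < n := by exact_mod_cast hn
  rw [eps, Del, one_div, ← Real.rpow_neg hn'.le, ← Real.rpow_add hn']
  norm_num

/-- Number of steps times drift per step. The factor `η` cancels against the step count, except for
the rounding of the ceiling, which costs the summand `ηmax`. -/
lemma ceil_mul_le {X ρ η ηmax δ M ε : ℝ} (hX1 : 1 ≤ X) (hη : 0 < η) (hηm : η ≤ ηmax)
    (hδ : 0 < δ) (hM : 0 ≤ M) (hε : 0 ≤ ε)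
    (hXl : (2 / δ * Real.log X + ηmax) * M * X ^ (-((ρ - 1 / 3) / 2)) ≤ 1 / 2) :
    (⌈2 * Real.log X / (η * (δ / X))⌉₊ : ℝ) *
      (η * (M * X ^ (-(ρ / 2)) / X) * (ε * X ^ (1 / 6 : ℝ))) ≤ ε / 2 := by
  have hX : 0 < X := by linarith
  have hlog : 0 ≤ Real.log X := Real.log_nonneg hX1
  have hm : (⌈2 * Real.log X / (η * (δ / X))⌉₊ : ℝ) ≤ 2 * Real.log X / (η * (δ / X)) + 1 :=
    (Nat.ceil_lt_add_one (by positivity)).le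
  generalize (⌈2 * Real.log X / (η * (δ / X))⌉₊ : ℝ) = m at hm
  have hmη : m * η ≤ (2 / δ * Real.log X + ηmax) * X := by
    calc m * η ≤ (2 * Real.log X / (η * (δ / X)) + 1) * η := by gcongr
      _ = 2 / δ * Real.log X * X + η := by field_simp
      _ ≤ 2 / δ * Real.log X * X + ηmax * X := by
          gcongr
          nlinarith
      _ = _ := by ring
  have h1 : X ^ (-(ρ / 2)) * X ^ (1 / 6 : ℝ) = X ^ (-((ρ - 1 / 3) / 2)) := by
    rw [← Real.rpow_add hX]
    congr 1; ring
  calc m * (η * (M * X ^ (-(ρ / 2)) / X) * (ε * X ^ (1 / 6 : ℝ)))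
      = m * η * (M * (X ^ (-(ρ / 2)) * X ^ (1 / 6 : ℝ)) * ε / X) := by ring
    _ ≤ (2 / δ * Real.log X + ηmax) * X *
          (M * (X ^ (-(ρ / 2)) * X ^ (1 / 6 : ℝ)) * ε / X) := by gcongr
    _ = (2 / δ * Real.log X + ηmax) * M * X ^ (-((ρ - 1 / 3) / 2)) * ε := by
        rw [h1]; field_simp
    _ ≤ 1 / 2 * ε := by gcongr
    _ = ε / 2 := by ring

/-- There is a unit vector `v` such that every Gaussian sample which is not too long and has a
nonnegligible component along `v` leads to a good embedding. -/
lemma exists_direction_of_scales {L T : ℕ} (hK : 2 ≤ K) (hT : 1 ≤ T) (hTL : T < L)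
    {ρ c δ ηmax κ B : ℝ} (hρ1 : ρ < 1) (hδ : 0 < δ) (hκ : 0 < κ) (hB : 0 < B)
    (hX2 : (2 : ℝ) ≤ n) (hX15 : 15 ≤ (n : ℝ) ^ (1 / 6 : ℝ))
    (hXc : |c| * (n : ℝ) ^ (-(ρ / 2)) ≤ δ / K)
    (hXA : 4 * (walkWeight L T + |c|) * (n : ℝ) ^ (-((ρ - 1 / 3) / 2)) ≤
      δ / K * (κ / √(2 * B)) / 2)
    (hXκ : 2 / (κ / √(2 * B)) ≤ (n : ℝ) ^ (1 / 3 : ℝ)) (hXδ : ηmax * (δ / K) ≤ n)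
    (hXs : ηmax * walkWeight L T ≤ n)
    (hXl : (2 / (δ / K) * Real.log n + ηmax) * (|c| + 4 * (walkWeight L T + |c|)) *
      (n : ℝ) ^ (-((ρ - 1 / 3) / 2)) ≤ 1 / 2)
    {σ : Fin n → Fin K} (hσ : Balanced σ) {p q : ℝ} (hq : 0 < q) (hqp : q < p)
    (hpq : δ * p ≤ p - q) {η : ℝ} (hη : 0 < η) (hηm : η ≤ ηmax) {C : Matrix (Fin n) (Fin n) ℝ}
    (hC : CloseToExpected c ρ C (expectedCoOccurrence L T σ p q)) :
    ∃ v : Emb n, ‖v‖ = 1 ∧ ∀ g : Fin n ⊕ Fin n → ℝ,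
      κ < |inner ℝ v (WithLp.toLp 2 g : Emb n)| →
      ‖(WithLp.toLp 2 g : Emb n)‖ ^ 2 < 2 * n * B →
      ∃ tf : ℕ, StopsAt C η g tf ∧
        ‖xPart (iterate C η g tf) - meanVec σ (xPart (iterate C η g tf))‖ ≤
          5 * ‖xPart (iterate C η g tf)‖ / Del n := by
  obtain ⟨R, -, hCR, hR⟩ := hC
  change ‖R‖ < _ at hR
  have hX : (0 : ℝ) < n := by linarith
  have hn : 0 < n := by exact_mod_cast hX
  have hX1 : (1 : ℝ) ≤ n := by linarith
  have hK' : (2 : ℝ) ≤ K := by exact_mod_cast hK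
  have hs : 0 < p + ((K : ℝ) - 1) * q := by nlinarith
  have hWt := walkWeight_nonneg hTL
  obtain ⟨hs2, hs3⟩ := communityWeight_bounds hK hT hTL hq hqp hpq
  set s := communityWeight K L T p q
  set Wt := walkWeight L T
  set X : ℝ := (n : ℝ) with hXdef
  set κ' := κ / √(2 * B) with hκ'
  have hκ'0 : 0 < κ' := by positivity
  set δ' := δ / K with hδ'
  have hδ'0 : 0 < δ' := by positivity
  have hs0 : 2 * δ' ≤ s := by rw [hδ']; linarith [mul_div_assoc 2 δ (K : ℝ)]
  have hε : 0 < eps n := by rw [eps]; positivity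
  set A := Wt + |c| with hA
  have hA0 : 0 ≤ A := by positivity
  have hR0 : ‖R‖ ≤ |c| * X ^ (-(ρ / 2)) / X := by
    refine hR.le.trans ?_
    have h1 : √(X ^ (ρ + 2)) = X ^ (ρ / 2) * X := by
      rw [Real.sqrt_eq_rpow, ← Real.rpow_mul hX.le, ← Real.rpow_add_one hX.ne']
      congr 1; ring
    rw [h1, Real.rpow_neg hX.le]
    calc c / (X ^ (ρ / 2) * X) ≤ |c| / (X ^ (ρ / 2) * X) := by gcongr; exact le_abs_self c
      _ = _ := by field_simp
  have hRn : ‖R‖ ≤ δ' / X := hR0.trans (by gcongr)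
  -- `D` bounds the row sums of `C`: those of `R` are at most `‖R‖√n`, of order `n^(-(1+ρ)/2)`,
  -- which dominates `1/n` as `ρ < 1`. Then `f = 4D/n` bounds the softmax error (with `(εΔ)² =
  -- 1/n`), and `e` bounds `‖R‖ + f`.
  set D := A * X ^ (-((1 + ρ) / 2)) with hDdef
  set f := 4 * D / X with hfdef
  set e := (|c| + 4 * A) * X ^ (-(ρ / 2)) / X with hedef
  -- Half of the lower bound `2δ'/n` for the community eigenvalue; the other half absorbs `‖R‖`.
  set l := δ' / X with hl
  have hl0 : 0 < l := by positivity
  obtain ⟨v, a, hv, hva, hHv⟩ :=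
    exists_dilation_eigenvector hσ hK hn (s / X) (R * (1 - meanProj n))
  have hR' : ‖R * (1 - meanProj n)‖ ≤ ‖R‖ :=
    (norm_mul_le _ _).trans (mul_le_of_le_one_right (norm_nonneg _)
      (norm_one_sub_le_one meanProj_isSymm (meanProj_mul_self hn)))
  have hla : l ≤ a := by
    have h1 : 2 * δ' / X ≤ s / X := by gcongr
    have h2 : 2 * δ' / X = l + l := by rw [hl]; ring
    linarith
  have hW : eps n * Del n = X ^ (-(1 / 2) : ℝ) := eps_mul_Del hn
  have hW2 : (eps n * Del n) ^ 2 = 1 / X := by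
    rw [hW, ← Real.rpow_natCast, ← Real.rpow_mul hX.le]
    norm_num [Real.rpow_neg_one]
  have hDelX : Del n = X ^ (1 / 6 : ℝ) := rfl
  have hηl : η * l ≤ 1 := by
    rw [hl, ← mul_div_assoc, div_le_one hX]
    exact (mul_le_mul_of_nonneg_right hηm hδ'0.le).trans hXδ
  refine ⟨v, hv, fun g hg1 hg2 => ?_⟩
  have hgne : (WithLp.toLp 2 g : Emb n) ≠ 0 := by
    intro h
    rw [h, inner_zero_right, abs_zero] at hg1
    linarith
  have hinit := abs_inner_initVec_ge hκ.le hB hn hg1 hg2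
  rw [← hκ', ← hXdef] at hinit
  have hsX : 0 ≤ s / X := div_nonneg (by linarith) hX.le
  -- The overlap `a₀` is of order `ε/√n`, and `m` is chosen so that `(1 + ηl)^m ≥ n`. This more than
  -- suffices, since `n · a₀` exceeds `εΔ` by a factor of order `n^(1/3)`.
  refine descent_recovers hσ (by omega) hn hs hCR (D := D) (f := f) (e := e) (l := l) (a := a)
    (a₀ := κ' * eps n * X ^ (-(1 / 2) : ℝ)) (m := ⌈2 * Real.log X / (η * l)⌉₊) (v := v)
    hη.le hX15 hε (norm_initVec hgne) ?_ ?_ ?_ ?_ hl0.le hla hsX ?_ hv ?_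
    (by positivity) hinit ?_ ?_ ?_
  · rw [hW2, div_le_div_iff₀ hX two_pos]; linarith
  · rw [abs_of_nonneg (by positivity : 0 ≤ Wt / (n : ℝ)), hDdef, hA, add_mul]
    refine add_le_add ?_ ?_
    · rw [div_eq_mul_inv, ← Real.rpow_neg_one]
      exact mul_le_mul_of_nonneg_left
        (Real.rpow_le_rpow_of_exponent_le hX1 (by linarith)) hWt
    · calc ‖R‖ * √X ≤ |c| * X ^ (-(ρ / 2)) / X * √X := by gcongr
        _ = |c| * (X ^ (-(ρ / 2)) * X ^ (-1 : ℝ) * X ^ (1 / 2 : ℝ)) := by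
            rw [Real.sqrt_eq_rpow, Real.rpow_neg_one]; ring
        _ = |c| * X ^ (-((1 + ρ) / 2)) := by
            rw [← Real.rpow_add hX, ← Real.rpow_add hX]
            congr 2; ring
  · rw [hW2, hfdef]; apply le_of_eq; ring
  · have h1 : X ^ (-((1 + ρ) / 2)) ≤ X ^ (-(ρ / 2)) :=
      Real.rpow_le_rpow_of_exponent_le hX1 (by linarith)
    calc ‖R‖ + f ≤ |c| * X ^ (-(ρ / 2)) / X + 4 * (A * X ^ (-(ρ / 2))) / X := by
          refine add_le_add hR0 ?_
          rw [hfdef, hDdef]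
          gcongr
      _ = e := by rw [hedef]; ring
  · rw [← mul_div_assoc, div_le_one hX]
    refine le_trans ?_ hXs
    calc η * s ≤ η * Wt := by gcongr
      _ ≤ ηmax * Wt := by gcongr
  · rw [hCR, mul_one_sub_meanProj hσ (by omega) hn hs]
    exact hHv
  · have h1 : X ^ (-((1 + ρ) / 2)) * X ^ (1 / 6 : ℝ) =
        X ^ (-((ρ - 1 / 3) / 2)) * X ^ (-(1 / 2) : ℝ) := by
      rw [← Real.rpow_add hX, ← Real.rpow_add hX]
      congr 1; ring
    rw [hfdef, hDdef, hl, hDelX]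
    calc 4 * (A * X ^ (-((1 + ρ) / 2))) / X * (eps n * X ^ (1 / 6 : ℝ))
        = 4 * A * (X ^ (-((1 + ρ) / 2)) * X ^ (1 / 6 : ℝ)) * eps n / X := by ring
      _ = (4 * A * X ^ (-((ρ - 1 / 3) / 2))) * (X ^ (-(1 / 2) : ℝ) * eps n / X) := by
          rw [h1]; ring
      _ ≤ (δ' * κ' / 2) * (X ^ (-(1 / 2) : ℝ) * eps n / X) := by gcongr
      _ = _ := by ring
  · have h1 : X ≤ (1 + η * l) ^ ⌈2 * Real.log X / (η * l)⌉₊ :=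
      le_one_add_pow hX (by positivity) hηl (Nat.le_ceil _)
    have h2 : X * X ^ (-(1 / 2) : ℝ) = X ^ (1 / 6 : ℝ) * X ^ (1 / 3 : ℝ) := by
      rw [← Real.rpow_add hX, ← Real.rpow_one_add' hX.le (by norm_num)]
      norm_num
    have h3 : 1 ≤ κ' / 2 * X ^ (1 / 3 : ℝ) := by
      rw [div_le_iff₀ hκ'0] at hXκ
      linarith
    calc eps n * Del n ≤ eps n * Del n * (κ' / 2 * X ^ (1 / 3 : ℝ)) :=
          le_mul_of_one_le_right (by rw [hDelX]; positivity) h3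
      _ = κ' / 2 * eps n * (X ^ (1 / 6 : ℝ) * X ^ (1 / 3 : ℝ)) := by rw [hDelX]; ring
      _ = X * (κ' * eps n * X ^ (-(1 / 2) : ℝ) / 2) := by rw [← h2]; ring
      _ ≤ _ := by gcongr
  · rw [hDelX]
    exact ceil_mul_le hX1 hη hηm hδ'0 (by positivity) hε.le hXl

end DeepWalk

end

/-! ### The main theorem -/

theorem theorem3p5 (K L T : ℕ) (hK : 2 ≤ K) (hT : 1 ≤ T) (hTL : T < L)
    (ρ : ℝ) (hρ : ρ ∈ Set.Ioo (1 / 3 : ℝ) 1) (c : ℝ)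
    (δ : ℝ) (hδ : 0 < δ) (ηmax : ℝ) (ζ : ℝ) (hζ : 0 < ζ) :
    ∃ n₀ : ℕ, ∀ n : ℕ, n₀ ≤ n →
      ∀ σ : Fin n → Fin K, DeepWalk.Balanced σ →
      ∀ p q : ℝ, 0 < q → q < p → p < 1 → δ * p ≤ p - q →
      ∀ η : ℝ, 0 < η → η ≤ ηmax →
      ∀ (Ω : Type*) [MeasurableSpace Ω] (P : Measure Ω) [IsProbabilityMeasure P]
        (A : Ω → Matrix (Fin n) (Fin n) ℝ), DeepWalk.IsSymmetricSBM P A σ p q →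
      ∀ᵐ ω ∂P,
        DeepWalk.CloseToExpected c ρ (DeepWalk.coOccurrence L T (A ω))
            (DeepWalk.expectedCoOccurrence L T σ p q) →
          DeepWalk.gaussianInit n
            {g | ¬ ∃ tf : ℕ, DeepWalk.StopsAt (DeepWalk.coOccurrence L T (A ω)) η g tf ∧
              ‖DeepWalk.xPart (DeepWalk.iterate (DeepWalk.coOccurrence L T (A ω)) η g tf) -
                  DeepWalk.meanVec σ
                    (DeepWalk.xPart
                      (DeepWalk.iterate (DeepWalk.coOccurrence L T (A ω)) η g tf))‖ ≤
                5 * ‖DeepWalk.xPart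
                      (DeepWalk.iterate (DeepWalk.coOccurrence L T (A ω)) η g tf)‖ /
                  DeepWalk.Del n} ≤ ENNReal.ofReal ζ := by
  have hδK : 0 < δ / K := by positivity
  -- The failure probability is split evenly: the threshold `ζ/2` for `|⟨v, g⟩|` and the factor `B =
  -- 2/ζ` in `‖g‖² < 2nB` each cost at most `ζ/2`.
  obtain ⟨n₀, hn₀⟩ := Filter.eventually_atTop.1 (tendsto_natCast_atTop_atTop.eventually
    (DeepWalk.eventually_scales (c := |c|) (δ := δ / K) (κ := ζ / 2 / √(2 * (2 / ζ)))
      (η := ηmax) (s := DeepWalk.walkWeight L T) hρ.1 hδK (by positivity)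
      (DeepWalk.walkWeight L T + |c|)))
  refine ⟨n₀, fun n hn σ hσ p q hq hqp _ hpq η hη hηm Ω _ P _ A _ => ?_⟩
  refine Filter.Eventually.of_forall fun ω hC => ?_
  obtain ⟨h1, h2, h3, h4, h5, h6, h7, h8⟩ := hn₀ n hn
  obtain ⟨v, hv, hgood⟩ := DeepWalk.exists_direction_of_scales hK hT hTL hρ.2 hδ
    (half_pos hζ) (by positivity : 0 < 2 / ζ) h1 h2 h3 h4 h5 h6 h7 h8 hσ hq hqp hpq hη hηm hC
  have hn : 0 < n := by
    have : (0 : ℝ) < n := by linarith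
    exact_mod_cast this
  calc _ ≤ DeepWalk.gaussianInit n
        ({g | |inner ℝ v (WithLp.toLp 2 g : DeepWalk.Emb n)| ≤ ζ / 2} ∪
          {g | 2 * n * (2 / ζ) ≤ ‖(WithLp.toLp 2 g : DeepWalk.Emb n)‖ ^ 2}) := by
        refine measure_mono fun g hg => ?_
        by_contra hcon
        rw [Set.mem_union, not_or] at hcon
        exact hg (hgood g (not_le.1 hcon.1) (not_le.1 hcon.2))
    _ ≤ ENNReal.ofReal (ζ / 2) + ENNReal.ofReal (1 / (2 / ζ)) :=
        (measure_union_le _ _).trans (add_le_add (DeepWalk.gaussianInit_abs_inner_le v hv _)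
          (DeepWalk.gaussianInit_le_norm_sq hn _ (by positivity)))
    _ = ENNReal.ofReal ζ := by
        rw [one_div_div, ← ENNReal.ofReal_add (by positivity) (by positivity), add_halves]
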